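/- Let $k$ be an algebraically closed field of characteristic $p>0$, let $h(x)\in k[x]$ be a polynomial of degree $d$ with $p\nmid d$, and let $X$ be the Artin–Schreier curve $y^p-y=h(x)$ over $k$, that is, the smooth projective curve with function field $k(x,y)$. Let $\pi:X\to\mathbb P^1$ be the cover given by $x$, let $U_1=\pi^{-1}(\mathbb P^1\setminus\{0\})$ and $U_2=\pi^{-1}(\mathbb P^1\setminus\{\infty\})$, and put, for $\mathcal U=\{U_1,U_2\}$, $H^1_{dR}(X)=Z^1_{dR}(\mathcal U)/B^1_{dR}(\mathcal U)$, where $$Z^1_{dR}(\mathcal U)=\{(t,\omega_1,\omega_2)\mid t\in\mathcal O_X(U_1\cap U_2),\ \omega_i\in\Omega^1_X(U_i),\ dt=\omega_1-\omega_2\},$$ $$B^1_{dR}(\mathcal U)=\{(t_1-t_2,dt_1,dt_2)\mid t_i\in\mathcal O_X(U_i)\}.$$ Put $s(x)=xh'(x)$, and let $s^{\le n}$ and $s^{>n}$ be the sums of the monomials of $s$ of degree $\le n$ and $>n$. Let $I$ be the set of all pairs of integers $i,j\ge 0$ with $pi+jd\le(p-1)(d-1)-2$. For $(i,j)\in I$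 put $$\alpha_{i,j}=\left(0,\;x^iy^j\,dx,\;x^iy^j\,dx\right)$$ and, for an integer $n\ge 0$, $$\beta^{(n)}_{i,j}=\left(\frac{y^{p-1-j}}{x^{i+1}},\;-\frac{\phi^{(n)}_{i,j}(x,y)}{x^{i+2}}\,dx,\;\frac{(p-1-j)\,s^{>n}(x)\,y^{p-2-j}}{x^{i+2}}\,dx\right),$$ where $\phi^{(n)}_{i,j}(x,y)=(p-1-j)\,s^{\le n}(x)\,y^{p-2-j}+(i+1)\,y^{p-1-j}$. 1. For all $(i,j)\in I$ the triples $\alpha_{i,j}$ and $\beta^{(i+1)}_{i,j}$ lie in $Z^1_{dR}(\mathcal U)$, and their residue classes, for $(i,j)\in I$, form a basis of $H^1_{dR}(X)$ over $k$. 2. If $d\ge p+1$, then the triples $\beta^{(i+2)}_{i,j}$ also lie in $Z^1_{dR}(\mathcal U)$, and the residue classes of the $\alpha_{i,j}$ and $\beta^{(i+2)}_{i,j}$, for $(i,j)\in I$, form a basis of $H^1_{dR}(X)$ over $k$. -/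

import Mathlib

open Polynomial
open scoped KaehlerDifferential

noncomputable section

/-! ## Smooth projective curves over `k` through their function fields

The smooth projective curve with function field `K` over the algebraically closed field `k`: its
closed points are the valuation rings `P` of `K` with `k ⊆ P ≠ K`, the local ring at the point `P`
is `P` itself, and functions and differential forms on a set `U` of points are the elements of `K`
and of `Ω[K⁄k]` that are regular at every point of `U`. -/

section Curve

variable (k K : Type*) [Field k] [Field K] [Algebra k K]

/-- The closed points of the smooth projective curve with function field `K`. -/
def Place : Type _ :=
  {P : ValuationSubring K // (∀ c : k, algebraMap k K c ∈ P) ∧ P ≠ ⊤}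

variable {k K}

/-- `𝒪_X(U)`: the rational functions that are regular at every point of `U`. -/
def regularFunctions (U : Set (Place k K)) : Subalgebra k K where
  carrier := {f | ∀ P ∈ U, f ∈ P.1}
  mul_mem' hf hg P hP := mul_mem (hf P hP) (hg P hP)
  add_mem' hf hg P hP := add_mem (hf P hP) (hg P hP)
  algebraMap_mem' c P _ := P.2.1 c

/-- The rational differential forms regular at `P`: the `𝒪_P`-submodule of `Ω[K⁄k]` generated by
the `dg` with `g ∈ 𝒪_P`, viewed as a `k`-subspace. -/
def regularFormsAt (P : Place k K) : Submodule k Ω[K⁄k] :=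
  Submodule.span k {η | ∃ f ∈ P.1, ∃ g ∈ P.1, η = f • KaehlerDifferential.D k K g}

/-- `Ω¹_X(U)`: the rational differential forms that are regular at every point of `U`. -/
def regularForms (U : Set (Place k K)) : Submodule k Ω[K⁄k] :=
  ⨅ P ∈ U, regularFormsAt P

/-- The 1-cocycles of the Čech–de Rham complex of the cover `{U₁, U₂}`: the triples
`(t, ω₁, ω₂)` with `t ∈ 𝒪(U₁ ∩ U₂)`, `ωᵢ ∈ Ω¹(Uᵢ)` and `dt = ω₁ - ω₂`. -/
def deRhamCocycles (U₁ U₂ : Set (Place k K)) : Submodule k (K × Ω[K⁄k] × Ω[K⁄k]) where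
  carrier := {z | z.1 ∈ regularFunctions (U₁ ∩ U₂) ∧ z.2.1 ∈ regularForms U₁ ∧
    z.2.2 ∈ regularForms U₂ ∧ KaehlerDifferential.D k K z.1 = z.2.1 - z.2.2}
  add_mem' := by
    rintro a b ⟨h1, h2, h3, h4⟩ ⟨h1', h2', h3', h4'⟩
    refine ⟨add_mem h1 h1', add_mem h2 h2', add_mem h3 h3', ?_⟩
    simp only [Prod.fst_add, Prod.snd_add, map_add, h4, h4']
    abel
  zero_mem' := ⟨zero_mem _, zero_mem _, zero_mem _, by simp⟩
  smul_mem' := by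
    rintro c a ⟨h1, h2, h3, h4⟩
    refine ⟨Subalgebra.smul_mem _ h1 c, Submodule.smul_mem _ c h2, Submodule.smul_mem _ c h3, ?_⟩
    simp only [Prod.smul_fst, Prod.smul_snd, Derivation.map_smul, h4, smul_sub]

/-- The 1-coboundaries `(t₁ - t₂, dt₁, dt₂)` with `tᵢ ∈ 𝒪(Uᵢ)`. -/
def deRhamCoboundaries (U₁ U₂ : Set (Place k K)) : Submodule k (K × Ω[K⁄k] × Ω[K⁄k]) where
  carrier := {z | ∃ t₁ ∈ regularFunctions U₁, ∃ t₂ ∈ regularFunctions U₂,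
    z = (t₁ - t₂, KaehlerDifferential.D k K t₁, KaehlerDifferential.D k K t₂)}
  add_mem' := by
    rintro _ _ ⟨s, hs, t, ht, rfl⟩ ⟨s', hs', t', ht', rfl⟩
    refine ⟨s + s', add_mem hs hs', t + t', add_mem ht ht', ?_⟩
    simp only [Prod.mk_add_mk, map_add]
    congr 1
    abel
  zero_mem' := ⟨0, zero_mem _, 0, zero_mem _, by simp only [map_zero, sub_zero]; rfl⟩
  smul_mem' := by
    rintro c _ ⟨s, hs, t, ht, rfl⟩
    refine ⟨c • s, Subalgebra.smul_mem _ hs c, c • t, Subalgebra.smul_mem _ ht c, ?_⟩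
    simp only [Prod.smul_mk, Derivation.map_smul, smul_sub]

/-- `H¹_dR(X)` computed by the cover `{U₁, U₂}`: cocycles modulo coboundaries. -/
abbrev DeRhamH1 (U₁ U₂ : Set (Place k K)) : Type _ :=
  deRhamCocycles U₁ U₂ ⧸ (deRhamCoboundaries U₁ U₂).submoduleOf (deRhamCocycles U₁ U₂)

/-- The class in `H¹_dR(X)` of a cocycle. -/
def deRhamClass {U₁ U₂ : Set (Place k K)} {z : K × Ω[K⁄k] × Ω[K⁄k]}
    (hz : z ∈ deRhamCocycles U₁ U₂) : DeRhamH1 U₁ U₂ :=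
  Submodule.Quotient.mk ⟨z, hz⟩

end Curve

/-! ## The function field of `y ^ p - y = h(x)` -/

section ArtinSchreier

variable {k : Type*} [Field k]

/-- The polynomial `Y ^ p - Y - h(x)` over `k(x)`. -/
def asPoly (p : ℕ) (h : k[X]) : (RatFunc k)[X] :=
  X ^ p - X - C (algebraMap k[X] (RatFunc k) h)

/-- `Y ^ p - Y - h(x)` has no root in `k(x)` if `p` is prime to `deg h`. -/
theorem asPoly_no_root (p : ℕ) [Fact p.Prime] (h : k[X])
    (hd : p.Coprime h.natDegree) (r : RatFunc k) :
    r ^ p - r ≠ algebraMap k[X] (RatFunc k) h := by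
  intro hr
  have hp := (Fact.out : p.Prime)
  have hint : IsIntegral k[X] r := by
    refine ⟨X ^ p - (X + C h), ?_, ?_⟩
    · refine monic_X_pow_sub ?_
      rw [degree_X_add_C]; exact_mod_cast hp.one_lt
    · simp [eval₂_sub, eval₂_add, ← hr]
  obtain ⟨q, rfl⟩ := IsIntegrallyClosed.isIntegral_iff.1 hint
  have hq : q ^ p - q = h := by
    apply IsFractionRing.injective k[X] (RatFunc k)
    simpa using hr
  have hdiv : p ∣ h.natDegree := by
    rcases Nat.eq_zero_or_pos q.natDegree with h0 | h0
    · rw [eq_C_of_natDegree_eq_zero h0, ← C_pow, ← C_sub] at hq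
      rw [← hq, natDegree_C]; exact dvd_zero p
    · rw [← hq, natDegree_sub_eq_left_of_natDegree_lt, natDegree_pow]
      · exact dvd_mul_right _ _
      · rw [natDegree_pow]; nlinarith [hp.one_lt]
  exact hp.one_lt.ne' (Nat.Coprime.eq_one_of_dvd hd hdiv)

/-- `Y ^ p - Y - h(x)` is irreducible over `k(x)` if `p` is prime to `deg h`; so the quotient
ring below is a field. -/
instance asPoly_irreducible (p : ℕ) [Fact p.Prime] [CharP k p] (h : k[X])
    [hd : Fact (p.Coprime h.natDegree)] : Fact (Irreducible (asPoly p h)) := by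
  have hp := (Fact.out : p.Prime)
  have : CharP (RatFunc k) p := charP_of_injective_algebraMap (algebraMap k (RatFunc k)).injective p
  have hform : asPoly p h = X ^ p - (X + C (algebraMap k[X] (RatFunc k) h)) := by
    rw [asPoly]; ring
  have hlt : (X + C (algebraMap k[X] (RatFunc k) h)).degree < (p : WithBot ℕ) := by
    rw [degree_X_add_C]; exact_mod_cast hp.one_lt
  have hmon : (asPoly p h).Monic := by rw [hform]; exact monic_X_pow_sub hlt
  have hdeg : (asPoly p h).natDegree = p := by
    rw [hform]; exact natDegree_eq_of_degree_eq_some (by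
      rw [degree_sub_eq_left_of_degree_lt (by simpa using hlt), degree_X_pow])
  refine ⟨hmon.irreducible_iff_natDegree'.2 ⟨?_, ?_⟩⟩
  · intro h1
    rw [h1, natDegree_one] at hdeg
    exact hp.ne_zero hdeg.symm
  intro f g hf hg hfg hmem
  rw [Finset.mem_Ioc, hdeg] at hmem
  have hgp : g.natDegree < p := by have := hp.two_le; omega
  let L := AlgebraicClosure (RatFunc k)
  let a := algebraMap (RatFunc k) L
  have : CharP L p := charP_of_injective_algebraMap a.injective p
  obtain ⟨r₀, hr₀⟩ := IsAlgClosed.exists_root (g.map a)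
    (by rw [degree_map]; exact (natDegree_pos_iff_degree_pos.1 hmem.1).ne')
  have hroot : ∀ r : L, (g.map a).IsRoot r →
      r ^ p - r = a (algebraMap k[X] (RatFunc k) h) := by
    intro r hr
    have h1 : ((asPoly p h).map a).eval r = 0 := by
      rw [← hfg, Polynomial.map_mul, eval_mul, hr.eq_zero, mul_zero]
    have h2 : r ^ p - r - a (algebraMap k[X] (RatFunc k) h) = 0 := by
      simpa [asPoly] using h1
    exact sub_eq_zero.1 h2
  have hdiff : ∀ r ∈ (g.map a).roots, r - r₀ ∈ a.fieldRange := by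
    intro r hr
    have hb : r - r₀ ∈ (⊥ : Subfield L) := by
      rw [Subfield.mem_bot_iff_pow_eq_self L p, sub_pow_char]
      linear_combination hroot r (isRoot_of_mem_roots hr) - hroot r₀ hr₀
    exact (bot_le : (⊥ : Subfield L) ≤ a.fieldRange) hb
  have hspl : (g.map a).Splits := IsAlgClosed.splits _
  have hcard : Multiset.card (g.map a).roots = g.natDegree := by
    rw [← hspl.natDegree_eq_card_roots, natDegree_map]
  have hsum : (g.map a).roots.sum ∈ a.fieldRange := by
    have h1 := hspl.nextCoeff_eq_neg_sum_roots_of_monic (hg.map a)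
    rw [nextCoeff_map a.injective] at h1
    exact ⟨-g.nextCoeff, by rw [map_neg, h1, neg_neg]⟩
  have hsum' : ((g.map a).roots.map (fun r => r - r₀)).sum ∈ a.fieldRange :=
    multiset_sum_mem _ (by
      intro c hc
      obtain ⟨r, hr, rfl⟩ := Multiset.mem_map.1 hc
      exact hdiff r hr)
  have hmr : (g.natDegree : L) * r₀ ∈ a.fieldRange := by
    have h1 : (g.natDegree : L) * r₀ =
        (g.map a).roots.sum - ((g.map a).roots.map (fun r => r - r₀)).sum := by
      simp [Multiset.sum_map_sub, hcard]
    rw [h1]; exact sub_mem hsum hsum'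
  have hne : (g.natDegree : L) ≠ 0 := by
    rw [Ne, CharP.cast_eq_zero_iff L p]
    exact Nat.not_dvd_of_pos_of_lt hmem.1 hgp
  have hr : r₀ ∈ a.fieldRange := by
    have h1 := mul_mem (inv_mem (natCast_mem a.fieldRange g.natDegree)) hmr
    rwa [inv_mul_cancel_left₀ hne] at h1
  obtain ⟨r, rfl⟩ := hr
  refine asPoly_no_root p h hd.out r (a.injective ?_)
  rw [map_sub, map_pow]
  exact hroot _ hr₀

/-- The function field `k(x, y)` of the curve `y ^ p - y = h(x)`. -/
abbrev ASField (p : ℕ) (h : k[X]) : Type _ := AdjoinRoot (asPoly p h)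

variable (p : ℕ) (h : k[X])

/-- The function `x`. -/
def asX : ASField p h := algebraMap (RatFunc k) (ASField p h) RatFunc.X

/-- The function `y`. -/
def asY : ASField p h := AdjoinRoot.root (asPoly p h)

/-- The part of degree at most `n` of the polynomial `s`. -/
def lowPart (s : k[X]) (n : ℕ) : k[X] := ∑ m ∈ s.support with m ≤ n, monomial m (s.coeff m)

/-- The part of degree greater than `n` of the polynomial `s`. -/
def highPart (s : k[X]) (n : ℕ) : k[X] := ∑ m ∈ s.support with n < m, monomial m (s.coeff m)

/-- The pairs `(i, j)` with `p i + j d ≤ (p - 1)(d - 1) - 2`, where `d = deg h` (the subtraction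
of `2` is moved to the left, so that it does not truncate). -/
abbrev ASIndex : Type :=
  {ij : ℕ × ℕ // p * ij.1 + ij.2 * h.natDegree + 2 ≤ (p - 1) * (h.natDegree - 1)}

variable [Fact p.Prime] [CharP k p] [Fact (p.Coprime h.natDegree)]

/-- `U₁`, the preimage of `ℙ¹ - {0}` under `x`: the points where `1 / x` is regular. -/
def asU₁ : Set (Place k (ASField p h)) := {P | (asX p h)⁻¹ ∈ P.1}

/-- `U₂`, the preimage of `ℙ¹ - {∞}` under `x`: the points where `x` is regular. -/
def asU₂ : Set (Place k (ASField p h)) := {P | asX p h ∈ P.1}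

/-- The form `dx`. -/
def asDx : Ω[ASField p h⁄k] := KaehlerDifferential.D k (ASField p h) (asX p h)

/-- The triple `(0, x ^ i y ^ j dx, x ^ i y ^ j dx)`. -/
def alphaTriple (i j : ℕ) : ASField p h × Ω[ASField p h⁄k] × Ω[ASField p h⁄k] :=
  (0, (asX p h ^ i * asY p h ^ j) • asDx p h, (asX p h ^ i * asY p h ^ j) • asDx p h)

/-- With `s = x h'(x)` cut into its parts of degree `≤ n` and `> n`, the triple
`(y ^ (p-1-j) / x ^ (i+1), - φ / x ^ (i+2) dx, (p-1-j) s^{>n} y ^ (p-2-j) / x ^ (i+2) dx)`,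
where `φ = (p-1-j) s^{≤n} y ^ (p-2-j) + (i+1) y ^ (p-1-j)`. -/
def betaTriple (n i j : ℕ) : ASField p h × Ω[ASField p h⁄k] × Ω[ASField p h⁄k] :=
  let x := asX p h
  let y := asY p h
  let s : k[X] := X * derivative h
  let φ := ((p - 1 - j : ℕ) : ASField p h) * aeval x (lowPart s n) * y ^ (p - 2 - j)
    + ((i + 1 : ℕ) : ASField p h) * y ^ (p - 1 - j)
  (y ^ (p - 1 - j) / x ^ (i + 1),
    (-(φ / x ^ (i + 2))) • asDx p h,
    (((p - 1 - j : ℕ) : ASField p h) * aeval x (highPart s n) * y ^ (p - 2 - j) / x ^ (i + 2)) •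
      asDx p h)

end ArtinSchreier

end

/-!
The affine curve `y ^ p - y = h(x)` is étale over the `x`-line, because the derivative of
`Y ^ p - Y - h` is the unit `-1`. Hence the integral closure of `k[x]` in the function field is
`k[x, y]`, which gives the functions on `U₂` and on `U₁ ∩ U₂` (a ring's integral closure is the
intersection of the valuation rings above it), and `dx` generates the forms on `U₂`. As `d` is
prime to `p`, the monomials `x ^ a y ^ b` with `0 ≤ b < p` have distinct pole orders `p a + b d` at
infinity, so regularity at infinity can be tested monomial by monomial; the form `dx` has there a
zero of order `c = p d - p - d - 1` (which is `2 g - 2`). Consequently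

* `𝒪(U₁ ∩ U₂)` has the basis of all `x ^ a y ^ b`, with `a` any integer;
* `𝒪(U₂)` is spanned by the monomials with `0 ≤ a`, and `Ω¹(U₂)` by their products with `dx`;
* `𝒪(U₁)` is spanned by the monomials with `p a + b d ≤ 0`, and `Ω¹(U₁)` by the products with `dx`
  of those with `p a + b d ≤ c`.

What remains is a comparison of exponents. The monomials in neither `𝒪(U₁)` nor `𝒪(U₂)` are exactly
the first components of the `β_{i,j}` (`range_betaExp`), those giving forms regular everywhere are
exactly the coefficients of the `α_{i,j}` (`range_alphaExp`), and only the constants are regular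
everywhere. So a cocycle can be changed by a unique combination of the `β_{i,j}` and a coboundary to
have first component `0`, and is then a global form, a unique combination of the `α_{i,j}`
(`exists_basis_deRhamH1`). The cut-off enters only through the question whether the `β_{i,j}` are
cocycles (`betaTriple_mem`).
-/

noncomputable section

/-! ### The function field as an extension of `k(x)` -/

section FunctionField

variable {k : Type*} [Field k] (p : ℕ) (h : k[X])

theorem algebraMap_eq_aeval_asX (q : k[X]) :
    algebraMap k[X] (ASField p h) q = aeval (asX p h) q := by
  rw [IsScalarTower.algebraMap_apply k[X] (RatFunc k) (ASField p h), asX, aeval_algebraMap_apply]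
  congr 1
  rw [RatFunc.X, aeval_algebraMap_apply, aeval_X_left_apply]

theorem asY_pow_sub : asY p h ^ p - asY p h = aeval (asX p h) h := by
  have h1 : aeval (asY p h) (X ^ p - X - C (algebraMap k[X] (RatFunc k) h)) = 0 := by
    change aeval (asY p h) (asPoly p h) = 0
    rw [asY, AdjoinRoot.aeval_eq, AdjoinRoot.mk_self]
  rw [map_sub, map_sub, map_pow, aeval_X, aeval_C,
    ← IsScalarTower.algebraMap_apply k[X] (RatFunc k) (ASField p h), sub_eq_zero] at h1
  rw [h1, algebraMap_eq_aeval_asX]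

theorem asPoly_eq : asPoly p h = X ^ p - (X + C (algebraMap k[X] (RatFunc k) h)) := by
  rw [asPoly]; ring

variable [hp : Fact p.Prime]

theorem degree_X_add_C_lt : (X + C (algebraMap k[X] (RatFunc k) h)).degree < (p : WithBot ℕ) := by
  rw [degree_X_add_C]; exact_mod_cast hp.out.one_lt

theorem asPoly_monic : (asPoly p h).Monic := by
  rw [asPoly_eq]; exact monic_X_pow_sub (degree_X_add_C_lt p h)

theorem asPoly_natDegree : (asPoly p h).natDegree = p := by
  rw [asPoly_eq]
  exact natDegree_eq_of_degree_eq_some (by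
    rw [degree_sub_eq_left_of_degree_lt (by simpa using degree_X_add_C_lt p h), degree_X_pow])

instance : Module.Finite (RatFunc k) (ASField p h) := (asPoly_monic p h).finite_adjoinRoot

variable [CharP k p]

omit hp in
theorem derivative_asPoly : derivative (asPoly p h) = -1 := by
  have : CharP (RatFunc k) p :=
    charP_of_injective_algebraMap (algebraMap k (RatFunc k)).injective p
  rw [asPoly, derivative_sub, derivative_sub, derivative_X_pow, derivative_X, derivative_C,
    CharP.cast_eq_zero]
  simp

omit hp in
theorem asPoly_separable : (asPoly p h).Separable :=
  ⟨0, -1, by rw [derivative_asPoly]; ring⟩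

variable [Fact (p.Coprime h.natDegree)]

instance : CharP (ASField p h) p :=
  charP_of_injective_algebraMap (algebraMap k (ASField p h)).injective p

/-- The power basis `1, y, …, y ^ (p - 1)` of the function field over `k(x)`. -/
def asPowerBasis : PowerBasis (RatFunc k) (ASField p h) :=
  AdjoinRoot.powerBasis (asPoly_monic p h).ne_zero

theorem asPowerBasis_gen : (asPowerBasis p h).gen = asY p h := rfl

theorem asPowerBasis_dim : (asPowerBasis p h).dim = p := asPoly_natDegree p h

theorem minpoly_asY : minpoly (RatFunc k) (asY p h) = asPoly p h := by
  rw [asY, AdjoinRoot.minpoly_root (asPoly_monic p h).ne_zero, (asPoly_monic p h).leadingCoeff]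
  simp

instance : Algebra.IsSeparable (RatFunc k) (ASField p h) := by
  have h1 : IsSeparable (RatFunc k) (asY p h) := by
    rw [IsSeparable, minpoly_asY]; exact asPoly_separable p h
  have h2 : IntermediateField.adjoin (RatFunc k) {asY p h} = ⊤ :=
    IntermediateField.adjoin_eq_top_of_algebra _ _ (asPowerBasis p h).adjoin_gen_eq_top
  rw [← IntermediateField.isSeparable_adjoin_simple_iff_isSeparable, h2] at h1
  exact Algebra.IsSeparable.of_algHom _ _
    (IntermediateField.topEquiv (F := RatFunc k) (E := ASField p h)).symm.toAlgHom

theorem isIntegral_asY : IsIntegral k[X] (asY p h) := by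
  refine ⟨X ^ p - (X + C h), monic_X_pow_sub ?_, ?_⟩
  · rw [degree_X_add_C]; exact_mod_cast hp.out.one_lt
  · simp only [eval₂_sub, eval₂_add, eval₂_X_pow, eval₂_X, eval₂_C, algebraMap_eq_aeval_asX,
      ← asY_pow_sub]
    ring

/-- The discriminant of `1, y, …, y ^ (p - 1)` is `± N(-1)`, a unit, so `k[x, y]` is the integral
closure of `k[x]` in the function field. -/
theorem mem_adjoin_of_isIntegral {f : ASField p h} (hf : IsIntegral k[X] f) :
    f ∈ Algebra.adjoin k[X] {asY p h} := by
  have h1 := Algebra.discr_mul_isIntegral_mem_adjoin (RatFunc k) (B := asPowerBasis p h)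
    (isIntegral_asY p h) hf
  have h2 : ∃ u : ℤˣ, Algebra.discr (RatFunc k) (asPowerBasis p h).basis = (u : ℤ) := by
    rw [Algebra.discr_powerBasis_eq_norm, asPowerBasis_gen, minpoly_asY, derivative_asPoly]
    let n := Module.finrank (RatFunc k) (ASField p h)
    refine ⟨(-1) ^ (n * (n - 1) / 2) * (-1) ^ n, ?_⟩
    have : aeval (asY p h) (-1 : (RatFunc k)[X]) = algebraMap (RatFunc k) (ASField p h) (-1) := by
      simp
    rw [this, Algebra.norm_algebraMap]
    push_cast
    rfl
  obtain ⟨u, hu⟩ := h2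
  rw [hu, asPowerBasis_gen] at h1
  have h3 : f = (u : ℤ) • ((u : RatFunc k) • f) := by
    rw [Int.cast_smul_eq_zsmul, smul_smul]
    simp [← Units.val_mul]
  rw [h3]
  exact zsmul_mem h1 _

end FunctionField

/-! ### Integrality and valuation rings -/

section Integrality

theorem exists_valuationSubring_of_not_isIntegral {R K : Type*} [CommRing R] [Field K]
    [Algebra R K] {f : K} (hf : ¬ IsIntegral R f) :
    ∃ V : ValuationSubring K, (∀ r, algebraMap R K r ∈ V) ∧ f ∉ V := by
  have h1 : f ∉ (integralClosure R K).toSubring := hf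
  obtain ⟨V, hV, hfV⟩ := Subring.exists_le_valuationSubring_of_isIntegrallyClosedIn h1
  exact ⟨V, fun r => hV (isIntegral_algebraMap (R := R)), hfV⟩

theorem ValuationSubring.mem_of_isIntegral_of_forall {R K : Type*} [CommRing R] [Field K]
    [Algebra R K] {V : ValuationSubring K} (hV : ∀ r, algebraMap R K r ∈ V) {f : K}
    (hf : IsIntegral R f) : f ∈ V := by
  let φ : R →+* V := (algebraMap R K).codRestrict V hV
  obtain ⟨q, hq, hq0⟩ := hf
  have h1 : IsIntegral V f := ⟨q.map φ, hq.map φ, by rw [eval₂_map]; exact hq0⟩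
  obtain ⟨g, rfl⟩ := IsIntegrallyClosed.isIntegral_iff.1 h1
  exact g.2

end Integrality

/-! ### Monomials, and functions regular on the affine parts -/

section Monomials

variable {k : Type*} [Field k] (p : ℕ) (h : k[X]) [hp : Fact p.Prime] [CharP k p]
  [hd : Fact (p.Coprime h.natDegree)]

omit hp [CharP k p] in
theorem natDegree_ne_zero_of_coprime [hp : Fact p.Prime] : h.natDegree ≠ 0 := by
  intro h0
  have h1 := hd.out
  rw [h0, Nat.coprime_zero_right] at h1
  exact hp.out.one_lt.ne' h1

theorem asX_ne_zero : asX p h ≠ 0 := by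
  rw [asX, Ne, FaithfulSMul.algebraMap_eq_zero_iff]
  exact RatFunc.X_ne_zero

/-- The monomial `x ^ a y ^ b` attached to `(a, b)`, with `a` an integer and `0 ≤ b < p`. -/
def asMon (m : ℤ × Fin p) : ASField p h := asX p h ^ m.1 * asY p h ^ (m.2 : ℕ)

omit hp [CharP k p] hd in
/-- The pole order `p a + b d` at infinity of the monomial `x ^ a y ^ b`. -/
def poleOrder (m : ℤ × Fin p) : ℤ := p * m.1 + m.2 * h.natDegree

/-- The span over `k` of the monomials with exponents in `S`. -/
def monSpan (S : Set (ℤ × Fin p)) : Submodule k (ASField p h) :=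
  Submodule.span k (asMon p h '' S)

variable {p h}

theorem asMon_mem_monSpan {S : Set (ℤ × Fin p)} {m : ℤ × Fin p} (hm : m ∈ S) :
    asMon p h m ∈ monSpan p h S :=
  Submodule.subset_span ⟨m, hm, rfl⟩

theorem monSpan_mono {S T : Set (ℤ × Fin p)} (hST : S ⊆ T) : monSpan p h S ≤ monSpan p h T :=
  Submodule.span_mono (Set.image_mono hST)

theorem aeval_mul_asY_pow_mem_monSpan (q : k[X]) (b : Fin p) :
    aeval (asX p h) q * asY p h ^ (b : ℕ) ∈ monSpan p h {m | 0 ≤ m.1} := by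
  rw [aeval_eq_sum_range, Finset.sum_mul]
  refine Submodule.sum_mem _ fun i _ => ?_
  rw [smul_mul_assoc]
  refine Submodule.smul_mem _ _ ?_
  have := asMon_mem_monSpan (h := h) (S := {m : ℤ × Fin p | 0 ≤ m.1}) (m := ((i : ℤ), b)) (by simp)
  simpa [asMon] using this

theorem mem_monSpan_of_isIntegral {f : ASField p h} (hf : IsIntegral k[X] f) :
    f ∈ monSpan p h {m | 0 ≤ m.1} := by
  have h1 := mem_adjoin_of_isIntegral p h hf
  rw [Algebra.adjoin_singleton_eq_range_aeval] at h1
  obtain ⟨q, rfl⟩ := h1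
  let g : k[X][X] := X ^ p - (X + C h)
  have hlt : (X + C h : k[X][X]).degree < (p : WithBot ℕ) := by
    rw [degree_X_add_C]; exact_mod_cast hp.out.one_lt
  have hg : g.Monic := monic_X_pow_sub hlt
  have hgd : g.degree = p := by
    rw [degree_sub_eq_left_of_degree_lt (by simpa using hlt), degree_X_pow]
  have hg0 : aeval (asY p h) g = 0 := by
    simp only [g, map_sub, map_add, map_pow, aeval_X, aeval_C, algebraMap_eq_aeval_asX,
      ← asY_pow_sub]
    ring
  have h2 : aeval (asY p h) q = aeval (asY p h) (q %ₘ g) := by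
    conv_lhs => rw [← modByMonic_add_div q g]
    rw [map_add, map_mul, hg0, zero_mul, add_zero]
  have h3 : (q %ₘ g).natDegree < p := by
    rcases eq_or_ne (q %ₘ g) 0 with h0 | h0
    · rw [h0, natDegree_zero]; exact hp.out.pos
    · rw [natDegree_lt_iff_degree_lt h0, ← hgd]; exact degree_modByMonic_lt _ hg
  change aeval (asY p h) q ∈ _
  rw [h2, aeval_eq_sum_range' h3]
  refine Submodule.sum_mem _ fun i hi => ?_
  rw [Algebra.smul_def, algebraMap_eq_aeval_asX]
  exact aeval_mul_asY_pow_mem_monSpan _ ⟨i, Finset.mem_range.1 hi⟩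

theorem mul_asX_zpow_mem_monSpan {f : ASField p h} (n : ℤ) (hf : f ∈ monSpan p h Set.univ) :
    f * asX p h ^ n ∈ monSpan p h Set.univ := by
  induction hf using Submodule.span_induction with
  | mem f hf =>
    obtain ⟨m, -, rfl⟩ := hf
    have := asMon_mem_monSpan (h := h) (Set.mem_univ (m.1 + n, m.2))
    convert this using 1
    rw [asMon, asMon, zpow_add₀ (asX_ne_zero p h)]
    ring
  | zero => simp
  | add f g _ _ hf hg => rw [add_mul]; exact add_mem hf hg
  | smul c f _ hf => rw [smul_mul_assoc]; exact Submodule.smul_mem _ _ hf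

theorem algebraMap_mem_place {P : Place k (ASField p h)} (hx : asX p h ∈ P.1) (q : k[X]) :
    algebraMap k[X] (ASField p h) q ∈ P.1 := by
  rw [algebraMap_eq_aeval_asX]
  have h1 : ∀ c : k, algebraMap k (ASField p h) c ∈ P.1 := P.2.1
  induction q using Polynomial.induction_on' with
  | add a b ha hb => rw [map_add]; exact add_mem ha hb
  | monomial n c => rw [aeval_monomial]; exact mul_mem (h1 c) (pow_mem hx n)

theorem mem_place_of_isIntegral {P : Place k (ASField p h)} (hx : asX p h ∈ P.1)
    {f : ASField p h} (hf : IsIntegral k[X] f) : f ∈ P.1 :=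
  ValuationSubring.mem_of_isIntegral_of_forall (algebraMap_mem_place hx) hf

theorem isIntegral_of_mem_regularFunctions {f : ASField p h}
    (hf : f ∈ regularFunctions (asU₂ p h)) : IsIntegral k[X] f := by
  by_contra hcon
  obtain ⟨V, hV, hfV⟩ := exists_valuationSubring_of_not_isIntegral hcon
  refine hfV (hf ⟨V, fun c => ?_, ?_⟩ ?_)
  · rw [IsScalarTower.algebraMap_apply k k[X] (ASField p h)]; exact hV _
  · rintro rfl; exact hfV trivial
  · have := hV X
    rwa [algebraMap_eq_aeval_asX, aeval_X] at this

/-- A function regular on `U₁ ∩ U₂` is integral over `k[x, 1 / x]`, so it becomes integral over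
`k[x]` after multiplication by a power of `x`. -/
theorem mem_monSpan_of_mem_regularFunctions_inter {f : ASField p h}
    (hf : f ∈ regularFunctions (asU₁ p h ∩ asU₂ p h)) : f ∈ monSpan p h Set.univ := by
  have hX : algebraMap k[X] (ASField p h) X = asX p h := by
    rw [algebraMap_eq_aeval_asX, aeval_X]
  have hu : IsUnit (algebraMap k[X] (ASField p h) X) := by
    rw [hX]; exact (asX_ne_zero p h).isUnit
  let φ : Localization.Away (X : k[X]) →+* ASField p h := IsLocalization.Away.lift X hu
  let : Algebra (Localization.Away (X : k[X])) (ASField p h) := φ.toAlgebra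
  have : IsScalarTower k[X] (Localization.Away (X : k[X])) (ASField p h) :=
    IsScalarTower.of_algebraMap_eq fun q => (IsLocalization.Away.lift_eq X hu q).symm
  have hint : IsIntegral (Localization.Away (X : k[X])) f := by
    by_contra hcon
    obtain ⟨V, hV, hfV⟩ := exists_valuationSubring_of_not_isIntegral hcon
    have hV' : ∀ q : k[X], algebraMap k[X] (ASField p h) q ∈ V := fun q => by
      rw [IsScalarTower.algebraMap_apply k[X] (Localization.Away (X : k[X])) (ASField p h)]
      exact hV _
    refine hfV (hf ⟨V, fun c => ?_, ?_⟩ ⟨?_, ?_⟩)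
    · rw [IsScalarTower.algebraMap_apply k k[X] (ASField p h)]; exact hV' _
    · rintro rfl; exact hfV trivial
    · have h1 := hV (IsLocalization.Away.invSelf (X : k[X]))
      have h2 : algebraMap (Localization.Away (X : k[X])) (ASField p h)
          (IsLocalization.Away.invSelf (X : k[X])) = (asX p h)⁻¹ := by
        refine eq_inv_of_mul_eq_one_right ?_
        rw [← hX,
          IsScalarTower.algebraMap_apply k[X] (Localization.Away (X : k[X])) (ASField p h),
          ← map_mul, IsLocalization.Away.mul_invSelf, map_one]
      rw [h2] at h1; exact h1
    · have := hV' X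
      rwa [hX] at this
  obtain ⟨⟨_, n, rfl⟩, hn⟩ :=
    hint.exists_multiple_integral_of_isLocalization (Submonoid.powers (X : k[X]))
  have h1 := mul_asX_zpow_mem_monSpan (-n : ℤ) (monSpan_mono (Set.subset_univ _)
    (mem_monSpan_of_isIntegral hn))
  convert h1 using 1
  rw [Submonoid.smul_def, Algebra.smul_def, map_pow, hX, zpow_neg, zpow_natCast]
  have := asX_ne_zero p h
  field_simp

end Monomials

/-! ### Differentials of the function field -/

section Differentials

variable {k : Type*} [Field k] (p : ℕ) (h : k[X]) [hp : Fact p.Prime] [CharP k p]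
  [hd : Fact (p.Coprime h.natDegree)]

/-- The function field is étale over `k[x]`: a localization followed by a separable extension. -/
instance : Algebra.FormallyEtale k[X] (ASField p h) := by
  have : Algebra.FormallyEtale k[X] (RatFunc k) :=
    Algebra.FormallyEtale.of_isLocalization (nonZeroDivisors k[X])
  have : Algebra.FormallyEtale (RatFunc k) (ASField p h) :=
    Algebra.FormallyEtale.of_isSeparable _ _
  exact Algebra.FormallyEtale.comp k[X] (RatFunc k) (ASField p h)

/-- The isomorphism `f dx ↦ f` of the module of differentials of the function field with the
function field itself. -/
def kaehlerEquiv : Ω[ASField p h⁄k] ≃ₗ[ASField p h] ASField p h :=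
  (KaehlerDifferential.tensorKaehlerEquivOfFormallyEtale k k[X] (ASField p h)).symm ≪≫ₗ
    TensorProduct.AlgebraTensorModule.congr (LinearEquiv.refl _ _)
      (KaehlerDifferential.polynomialEquiv k) ≪≫ₗ
    TensorProduct.AlgebraTensorModule.rid k[X] (ASField p h) (ASField p h)

/-- The derivation `d/dx` of the function field. -/
def asDeriv : Derivation k (ASField p h) (ASField p h) :=
  (kaehlerEquiv p h).toLinearMap.compDer (KaehlerDifferential.D k (ASField p h))

theorem asDeriv_apply (f : ASField p h) :
    asDeriv p h f = kaehlerEquiv p h (KaehlerDifferential.D k (ASField p h) f) := rfl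

theorem asDeriv_aeval (q : k[X]) :
    asDeriv p h (aeval (asX p h) q) = aeval (asX p h) (derivative q) := by
  rw [← algebraMap_eq_aeval_asX, asDeriv_apply, kaehlerEquiv,
    LinearEquiv.trans_apply, LinearEquiv.trans_apply,
    KaehlerDifferential.tensorKaehlerEquivOfFormallyEtale_symm_D_algebraMap,
    TensorProduct.AlgebraTensorModule.congr_tmul,
    KaehlerDifferential.polynomialEquiv_D, TensorProduct.AlgebraTensorModule.rid_tmul,
    LinearEquiv.refl_apply, ← algebraMap_eq_aeval_asX, Algebra.smul_def, mul_one]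

theorem asDeriv_asX : asDeriv p h (asX p h) = 1 := by
  simpa using asDeriv_aeval p h X

theorem asDeriv_asY : asDeriv p h (asY p h) = -aeval (asX p h) (derivative h) := by
  have h1 := asDeriv_aeval p h h
  rw [← asY_pow_sub, map_sub, Derivation.leibniz_pow, ← Nat.cast_smul_eq_nsmul (ASField p h),
    CharP.cast_eq_zero, zero_smul, zero_sub] at h1
  rw [← h1, neg_neg]

theorem kaehlerEquiv_asDx : kaehlerEquiv p h (asDx p h) = 1 := by
  rw [asDx, ← asDeriv_apply, asDeriv_asX]

theorem kaehlerEquiv_smul_asDx (f : ASField p h) : kaehlerEquiv p h (f • asDx p h) = f := by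
  rw [map_smul, kaehlerEquiv_asDx, smul_eq_mul, mul_one]

theorem kaehlerEquiv_smul_asDx_self (ω : Ω[ASField p h⁄k]) :
    kaehlerEquiv p h ω • asDx p h = ω :=
  (kaehlerEquiv p h).injective (kaehlerEquiv_smul_asDx p h _)

theorem D_eq_asDeriv_smul (f : ASField p h) :
    KaehlerDifferential.D k (ASField p h) f = asDeriv p h f • asDx p h :=
  (kaehlerEquiv_smul_asDx_self p h _).symm

theorem asDeriv_asY_pow (n : ℕ) : asDeriv p h (asY p h ^ n) =
    -((n : ASField p h) * aeval (asX p h) (derivative h) * asY p h ^ (n - 1)) := by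
  rw [Derivation.leibniz_pow, asDeriv_asY, smul_eq_mul, nsmul_eq_mul]
  ring

theorem asDeriv_asX_zpow (n : ℤ) :
    asDeriv p h (asX p h ^ n) = n * asX p h ^ (n - 1) := by
  rw [Derivation.leibniz_zpow, asDeriv_asX]
  simp

theorem smul_asDx_mem_regularFormsAt_iff {P : Place k (ASField p h)} {f : ASField p h} :
    f • asDx p h ∈ regularFormsAt P ↔
      f ∈ Submodule.span k {c | ∃ a ∈ P.1, ∃ b ∈ P.1, c = a * asDeriv p h b} := by
  let e : Ω[ASField p h⁄k] ≃ₗ[k] ASField p h := (kaehlerEquiv p h).restrictScalars k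
  have h1 : (regularFormsAt P).map (e : Ω[ASField p h⁄k] →ₗ[k] ASField p h) =
      Submodule.span k {c | ∃ a ∈ P.1, ∃ b ∈ P.1, c = a * asDeriv p h b} := by
    rw [regularFormsAt, Submodule.map_span]
    congr 1
    ext c
    constructor
    · rintro ⟨_, ⟨a, ha, b, hb, rfl⟩, rfl⟩
      exact ⟨a, ha, b, hb, (kaehlerEquiv p h).map_smul _ _⟩
    · rintro ⟨a, ha, b, hb, rfl⟩
      exact ⟨_, ⟨a, ha, b, hb, rfl⟩, (kaehlerEquiv p h).map_smul _ _⟩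
  rw [← h1]
  constructor
  · intro hf
    exact ⟨_, hf, kaehlerEquiv_smul_asDx p h f⟩
  · rintro ⟨ω, hω, rfl⟩
    have := kaehlerEquiv_smul_asDx_self p h ω
    change kaehlerEquiv p h ω • asDx p h ∈ _
    rwa [this]

end Differentials

/-! ### Valuation rings above a Dedekind domain -/

section Dedekind

/-- A valuation ring `V` of the fraction field `K` of a Dedekind domain `O ⊆ V` consists of
fractions whose denominators are units of `V`: the localization of `O` at the centre of `V` is
itself a valuation ring, dominated by `V`. -/
theorem ValuationSubring.exists_mul_eq_of_isDedekindDomain {O K : Type*} [CommRing O]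
    [IsDedekindDomain O] [Field K] [Algebra O K] [IsFractionRing O K] {V : ValuationSubring K}
    (hV : ∀ r, algebraMap O K r ∈ V) {g : K} (hg : g ∈ V) :
    ∃ a s : O, algebraMap O K s ≠ 0 ∧ (algebraMap O K s)⁻¹ ∈ V ∧
      g * algebraMap O K s = algebraMap O K a := by
  let φ : O →+* V := (algebraMap O K).codRestrict V hV
  let m : Ideal O := (IsLocalRing.maximalIdeal V).comap φ
  have hinj : Function.Injective (algebraMap O K) := IsFractionRing.injective O K
  have hunit : ∀ s : O, s ∉ m → algebraMap O K s ≠ 0 ∧ (algebraMap O K s)⁻¹ ∈ V := by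
    intro s hs
    have h1 : IsUnit (φ s) := by
      by_contra hcon
      exact hs ((IsLocalRing.mem_maximalIdeal _).2 hcon)
    obtain ⟨t, ht⟩ := h1.exists_right_inv
    have h2 : algebraMap O K s * (t : K) = 1 := congrArg Subtype.val ht
    refine ⟨left_ne_zero_of_mul_eq_one h2, ?_⟩
    rw [← eq_inv_of_mul_eq_one_right h2]
    exact t.2
  obtain ⟨b, a, ha, rfl⟩ := IsFractionRing.div_surjective (A := O) g
  have ha0 : algebraMap O K a ≠ 0 :=
    (map_ne_zero_iff _ hinj).2 (nonZeroDivisors.ne_zero ha)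
  by_cases hm : m = ⊥
  · refine ⟨b, a, ha0, (hunit a ?_).2, div_mul_cancel₀ _ ha0⟩
    rw [hm]
    exact nonZeroDivisors.ne_zero ha
  have : IsDiscreteValuationRing (Localization.AtPrime m) :=
    IsLocalization.AtPrime.isDiscreteValuationRing_of_dedekind_domain O hm _
  have hdvd : ∀ u v : O, algebraMap O (Localization.AtPrime m) u ∣
      algebraMap O (Localization.AtPrime m) v → ∃ c s : O, s ∉ m ∧ s * v = u * c := by
    rintro u v ⟨w, hw⟩
    obtain ⟨⟨c, s⟩, hcs⟩ := IsLocalization.surj m.primeCompl w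
    refine ⟨c, s, s.2, ?_⟩
    apply IsLocalization.injective (Localization.AtPrime m) m.primeCompl_le_nonZeroDivisors
    rw [map_mul, map_mul, hw, ← hcs]
    ring
  rcases ValuationRing.dvd_total (algebraMap O (Localization.AtPrime m) a)
    (algebraMap O (Localization.AtPrime m) b) with h1 | h1
  · obtain ⟨c, s, hs, hc⟩ := hdvd _ _ h1
    refine ⟨c, s, (hunit s hs).1, (hunit s hs).2, ?_⟩
    have h2 := congrArg (algebraMap O K) hc
    rw [map_mul, map_mul] at h2
    rw [div_mul_eq_mul_div, mul_comm, h2, mul_div_cancel_left₀ _ ha0]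
  · obtain ⟨c, s, hs, hc⟩ := hdvd _ _ h1
    have h2 := congrArg (algebraMap O K) hc
    rw [map_mul, map_mul] at h2
    have h3 : algebraMap O K b / algebraMap O K a * algebraMap O K c = algebraMap O K s := by
      rw [div_mul_eq_mul_div, ← h2, mul_div_cancel_right₀ _ ha0]
    have hcm : c ∉ m := by
      intro hcm
      apply hs
      have h4 : φ s = ⟨_, hg⟩ * φ c := Subtype.ext h3.symm
      change φ s ∈ IsLocalRing.maximalIdeal V
      rw [h4]
      exact Ideal.mul_mem_left _ _ hcm
    exact ⟨s, c, (hunit c hcm).1, (hunit c hcm).2, h3⟩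

end Dedekind

/-! ### Differentials at the affine places -/

section AffinePlaces

variable {k : Type*} [Field k] {p : ℕ} {h : k[X]} [hp : Fact p.Prime] [CharP k p]
  [hd : Fact (p.Coprime h.natDegree)]

theorem isIntegral_asDeriv {f : ASField p h} (hf : IsIntegral k[X] f) :
    IsIntegral k[X] (asDeriv p h f) := by
  have hq : ∀ q : k[X], IsIntegral k[X] (aeval (asX p h) q) := fun q => by
    rw [← algebraMap_eq_aeval_asX]; exact isIntegral_algebraMap
  have hadj : ∀ f ∈ Algebra.adjoin k[X] {asY p h}, IsIntegral k[X] f := fun f hf => by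
    refine (Algebra.adjoin_le (S := integralClosure k[X] (ASField p h)) ?_ hf :)
    rintro _ rfl
    exact isIntegral_asY p h
  replace hf := mem_adjoin_of_isIntegral p h hf
  induction hf using Algebra.adjoin_induction with
  | mem f hf =>
    rw [Set.mem_singleton_iff.1 hf, asDeriv_asY]
    exact (hq _).neg
  | algebraMap q =>
    rw [algebraMap_eq_aeval_asX, asDeriv_aeval]
    exact hq _
  | add f g hf hg ihf ihg =>
    rw [map_add]
    exact ihf.add ihg
  | mul f g hf hg ihf ihg =>
    rw [Derivation.leibniz, smul_eq_mul, smul_eq_mul]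
    exact ((hadj f hf).mul ihg).add ((hadj g hg).mul ihf)

/-- At a place where `x` is regular, `d/dx` preserves regularity (so `dx` generates the regular
forms there). -/
theorem asDeriv_mem_place {P : Place k (ASField p h)} (hx : asX p h ∈ P.1) {g : ASField p h}
    (hg : g ∈ P.1) : asDeriv p h g ∈ P.1 := by
  let O := integralClosure k[X] (ASField p h)
  have : IsDedekindDomain O := integralClosure.isDedekindDomain k[X] (RatFunc k) (ASField p h)
  have : IsFractionRing O (ASField p h) :=
    integralClosure.isFractionRing_of_finite_extension (RatFunc k) (ASField p h)
  obtain ⟨a, s, hs0, hs, hgs⟩ := ValuationSubring.exists_mul_eq_of_isDedekindDomain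
    (O := O) (fun r => mem_place_of_isIntegral hx r.2) hg
  have h1 := congrArg (asDeriv p h) hgs
  rw [Derivation.leibniz, smul_eq_mul, smul_eq_mul] at h1
  have h2 : asDeriv p h g =
      (asDeriv p h (algebraMap O _ a) - g * asDeriv p h (algebraMap O _ s)) *
        (algebraMap O (ASField p h) s)⁻¹ := by
    rw [← h1]
    field_simp
    ring
  rw [h2]
  exact mul_mem (sub_mem (mem_place_of_isIntegral hx (isIntegral_asDeriv a.2))
    (mul_mem hg (mem_place_of_isIntegral hx (isIntegral_asDeriv s.2)))) hs

theorem smul_asDx_mem_regularFormsAt_iff_of_asX_mem {P : Place k (ASField p h)}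
    (hx : asX p h ∈ P.1) {f : ASField p h} :
    f • asDx p h ∈ regularFormsAt P ↔ f ∈ P.1 := by
  rw [smul_asDx_mem_regularFormsAt_iff]
  constructor
  · intro hf
    induction hf using Submodule.span_induction with
    | mem f hf =>
      obtain ⟨a, ha, b, hb, rfl⟩ := hf
      exact mul_mem ha (asDeriv_mem_place hx hb)
    | zero => exact zero_mem _
    | add f g _ _ hf hg => exact add_mem hf hg
    | smul c f _ hf => rw [Algebra.smul_def]; exact mul_mem (P.2.1 c) hf
  · intro hf
    exact Submodule.subset_span ⟨f, hf, asX p h, hx, by rw [asDeriv_asX, mul_one]⟩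

end AffinePlaces

/-! ### Sums of terms with distinct values -/

section Valuations

/-- If the nonzero terms of a sum have distinct values then no term exceeds the sum. -/
theorem Valuation.map_le_map_sum_of_injOn {R Γ ι : Type*} [Ring R]
    [LinearOrderedCommGroupWithZero Γ] (v : Valuation R Γ) {s : Finset ι} {f : ι → R}
    (hf : ∀ i ∈ s, ∀ j ∈ s, v (f i) ≠ 0 → v (f i) = v (f j) → i = j) {i : ι} (hi : i ∈ s) :
    v (f i) ≤ v (∑ i ∈ s, f i) := by
  classical
  obtain ⟨j, hj, hmax⟩ := s.exists_max_image (fun i => v (f i)) ⟨i, hi⟩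
  rcases eq_or_ne (v (f j)) 0 with h0 | h0
  · exact (hmax i hi).trans (h0.trans_le zero_le)
  · rw [v.map_sum_eq_of_lt hj fun l hl => ?_]
    · exact hmax i hi
    · rw [Finset.mem_sdiff, Finset.mem_singleton] at hl
      exact (hmax l hl.1).lt_of_ne fun h1 => hl.2 (hf j hj l hl.1 h0 h1.symm).symm

end Valuations

/-! ### Functions at infinity -/

section Infinity

variable {k : Type*} [Field k] {p : ℕ} {h : k[X]} [hp : Fact p.Prime] [CharP k p]
  [hd : Fact (p.Coprime h.natDegree)]

variable (p h) in
/-- There is a place above the point at infinity of the projective line. -/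
theorem exists_place_asX_notMem : ∃ P : Place k (ASField p h), asX p h ∉ P.1 := by
  classical
  let R : ValuationSubring (RatFunc k) := (RatFunc.inftyValuation k).valuationSubring
  have hnot : ¬ IsIntegral R (asX p h) := by
    rw [asX, isIntegral_algebraMap_iff (algebraMap (RatFunc k) (ASField p h)).injective]
    intro hcon
    obtain ⟨g, hg⟩ := IsIntegrallyClosed.isIntegral_iff.1 hcon
    have h1 : RatFunc.X ∈ R := by rw [← hg]; exact g.2
    rw [Valuation.mem_valuationSubring_iff, RatFunc.inftyValuation.X] at h1
    exact absurd h1 (by simp [← WithZero.exp_zero])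
  obtain ⟨V, hV, hxV⟩ := exists_valuationSubring_of_not_isIntegral hnot
  refine ⟨⟨V, fun c => ?_, ?_⟩, hxV⟩
  · have hc : RatFunc.C c ∈ R := by
      rw [Valuation.mem_valuationSubring_iff]
      rcases eq_or_ne c 0 with rfl | hc
      · simp
      · rw [RatFunc.inftyValuation.C k hc]
    exact hV ⟨_, hc⟩
  · rintro rfl; exact hxV trivial

variable {P : Place k (ASField p h)}

theorem valuation_algebraMap {c : k} (hc : c ≠ 0) :
    P.1.valuation (algebraMap k (ASField p h) c) = 1 := by
  have h1 : ∀ c : k, P.1.valuation (algebraMap k (ASField p h) c) ≤ 1 := fun c =>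
    (P.1.valuation_le_one_iff _).2 (P.2.1 c)
  refine le_antisymm (h1 c) ?_
  have h2 := h1 c⁻¹
  rw [map_inv₀, map_inv₀] at h2
  refine (inv_le_one₀ ?_).1 h2
  rw [zero_lt_iff, Valuation.ne_zero_iff]
  simpa using hc

theorem valuation_smul {c : k} (hc : c ≠ 0) (f : ASField p h) :
    P.1.valuation (c • f) = P.1.valuation f := by
  rw [Algebra.smul_def, map_mul, valuation_algebraMap hc, one_mul]

theorem one_lt_valuation_asX (hx : asX p h ∉ P.1) : 1 < P.1.valuation (asX p h) :=
  not_le.1 fun h1 => hx ((P.1.valuation_le_one_iff _).1 h1)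

theorem valuation_aeval_asX (hx : asX p h ∉ P.1) {q : k[X]} (hq : q ≠ 0) :
    P.1.valuation (aeval (asX p h) q) = P.1.valuation (asX p h) ^ (q.natDegree : ℤ) := by
  have : P.1.valuation.IsTrivialOn k := ⟨fun c hc => valuation_algebraMap hc⟩
  rw [valuation_aeval_eq_valuation_X_pow_natDegree_of_one_lt_valuation_X _
    (one_lt_valuation_asX hx) hq, zpow_natCast]

theorem valuation_asY_pow (hx : asX p h ∉ P.1) :
    P.1.valuation (asY p h) ^ p = P.1.valuation (asX p h) ^ (h.natDegree : ℤ) := by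
  have hd0 := natDegree_ne_zero_of_coprime p h
  have h1 := valuation_aeval_asX hx (q := h) (by rintro rfl; simp at hd0)
  rw [← asY_pow_sub] at h1
  have h2 : 1 < P.1.valuation (asX p h) ^ (h.natDegree : ℤ) := by
    rw [zpow_natCast]; exact one_lt_pow₀ (one_lt_valuation_asX hx) hd0
  have h3 : 1 < P.1.valuation (asY p h) := by
    by_contra! hcon
    have hy := (P.1.valuation_le_one_iff _).1 hcon
    have h4 := (P.1.valuation_le_one_iff _).2 (sub_mem (pow_mem hy p) hy)
    rw [h1] at h4
    exact h2.not_ge h4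
  rw [← h1, Valuation.map_sub_eq_of_lt_left, map_pow]
  rw [map_pow]
  exact lt_self_pow₀ h3 hp.out.one_lt

theorem asY_notMem (hx : asX p h ∉ P.1) : asY p h ∉ P.1 := by
  intro hy
  have h1 := pow_le_one₀ zero_le ((P.1.valuation_le_one_iff _).2 hy) (n := p)
  rw [valuation_asY_pow hx, zpow_natCast] at h1
  exact (one_lt_pow₀ (one_lt_valuation_asX hx) (natDegree_ne_zero_of_coprime p h)).not_ge h1

/-- Pole orders at infinity are read off from `p`-th powers of values: `y ^ p` has the value of
`x ^ d`, so all of these are powers of the value of `x`, and no uniformizer is needed. -/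
theorem valuation_mul_asY_zpow (hx : asX p h ∉ P.1) {c : ASField p h} {n : ℤ}
    (hc : P.1.valuation c = P.1.valuation (asX p h) ^ n) (b : ℤ) :
    P.1.valuation (c * asY p h ^ b) ^ p =
      P.1.valuation (asX p h) ^ (p * n + b * h.natDegree) := by
  have hw := (zero_lt_one.trans (one_lt_valuation_asX hx)).ne'
  have h1 : (P.1.valuation (asY p h) ^ b) ^ p = (P.1.valuation (asY p h) ^ p) ^ b := by
    rw [← zpow_natCast, ← zpow_natCast, ← zpow_mul, ← zpow_mul, mul_comm]
  rw [map_mul, hc, map_zpow₀, mul_pow, h1, valuation_asY_pow hx, ← zpow_natCast _ p, ← zpow_mul,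
    ← zpow_mul, ← zpow_add₀ hw]
  congr 1
  ring

theorem valuation_mul_asY_zpow_le (hx : asX p h ∉ P.1) {c : ASField p h} {n : ℤ}
    (hc : P.1.valuation c ≤ P.1.valuation (asX p h) ^ n) (b : ℤ) :
    P.1.valuation (c * asY p h ^ b) ^ p ≤
      P.1.valuation (asX p h) ^ (p * n + b * h.natDegree) := by
  rw [← valuation_mul_asY_zpow hx (map_zpow₀ _ _ n) b, map_mul, map_mul, map_zpow₀ _ (asX p h)]
  exact pow_le_pow_left₀ zero_le (mul_le_mul_left hc _) p

theorem valuation_asMon (hx : asX p h ∉ P.1) (m : ℤ × Fin p) :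
    P.1.valuation (asMon p h m) ^ p = P.1.valuation (asX p h) ^ poleOrder p h m := by
  have := valuation_mul_asY_zpow hx (c := asX p h ^ m.1) (map_zpow₀ _ _ _) m.2
  rwa [zpow_natCast] at this

omit [CharP k p] hp in
/-- The pole orders of the monomials are distinct, since `d` is prime to `p`. -/
theorem poleOrder_injective [hp : Fact p.Prime] : Function.Injective (poleOrder p h) := by
  rintro ⟨a, b⟩ ⟨a', b'⟩ heq
  simp only [poleOrder] at heq
  have h1 : (p : ℤ) ∣ ((b : ℤ) - b') * h.natDegree := ⟨a' - a, by linear_combination heq⟩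
  have h2 : (p : ℤ) ∣ (b : ℤ) - b' :=
    IsCoprime.dvd_of_dvd_mul_right (Nat.isCoprime_iff_coprime.2 hd.out) h1
  have h3 : (b : ℤ) - b' = 0 := by
    refine Int.eq_zero_of_abs_lt_dvd h2 ?_
    have := b.2
    have := b'.2
    rw [abs_lt]
    constructor <;> omega
  have h4 : b = b' := Fin.ext (by omega)
  subst h4
  have h5 : (p : ℤ) * (a - a') = 0 := by linear_combination heq
  have h6 : (p : ℤ) ≠ 0 := by exact_mod_cast hp.out.ne_zero
  have h7 := (mul_eq_zero.1 h5).resolve_left h6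
  rw [sub_eq_zero.1 h7]

/-- No term of a combination of monomials has a pole at infinity of higher order than the sum. -/
theorem valuation_term_le (hx : asX p h ∉ P.1) (c : ℤ × Fin p →₀ k) {m : ℤ × Fin p}
    (hm : m ∈ c.support) : P.1.valuation (asMon p h m) ≤
      P.1.valuation (Finsupp.linearCombination k (asMon p h) c) := by
  rw [← valuation_smul (Finsupp.mem_support_iff.1 hm), Finsupp.linearCombination_apply,
    Finsupp.sum]
  refine Valuation.map_le_map_sum_of_injOn _ (f := fun m => c m • asMon p h m)
    (fun i hi j hj _ hij => ?_) hm
  rw [valuation_smul (Finsupp.mem_support_iff.1 hi),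
    valuation_smul (Finsupp.mem_support_iff.1 hj)] at hij
  have h1 := congrArg (· ^ p) hij
  simp only [valuation_asMon hx] at h1
  exact poleOrder_injective (zpow_right_injective₀
    (zero_lt_one.trans (one_lt_valuation_asX hx)) (one_lt_valuation_asX hx).ne' h1)

theorem asMon_ne_zero (hx : asX p h ∉ P.1) (m : ℤ × Fin p) : asMon p h m ≠ 0 := by
  refine mul_ne_zero (zpow_ne_zero _ (asX_ne_zero p h)) (pow_ne_zero _ ?_)
  intro hy
  exact asY_notMem hx (hy ▸ zero_mem _)

variable (p h) in
theorem linearIndependent_asMon : LinearIndependent k (asMon p h) := by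
  obtain ⟨P, hx⟩ := exists_place_asX_notMem p h
  rw [linearIndependent_iff]
  intro c hc
  by_contra hcon
  obtain ⟨m, hm⟩ := Finsupp.support_nonempty_iff.2 hcon
  have h1 := valuation_term_le hx c hm
  rw [hc, map_zero, le_zero_iff, Valuation.zero_iff] at h1
  exact asMon_ne_zero hx m h1

theorem valuation_pow_add_le {f g : ASField p h} {γ : P.1.ValueGroup}
    (hf : P.1.valuation f ^ p ≤ γ) (hg : P.1.valuation g ^ p ≤ γ) :
    P.1.valuation (f + g) ^ p ≤ γ := by
  rcases le_max_iff.1 (P.1.valuation.map_add f g) with h1 | h1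
  · exact (pow_le_pow_left₀ zero_le h1 p).trans hf
  · exact (pow_le_pow_left₀ zero_le h1 p).trans hg

theorem valuation_smul_le (c : k) (f : ASField p h) :
    P.1.valuation (c • f) ≤ P.1.valuation f := by
  rcases eq_or_ne c 0 with rfl | hc
  · simp
  · rw [valuation_smul hc]

theorem valuation_pow_le_of_mem_monSpan (hx : asX p h ∉ P.1) {f : ASField p h} {N : ℤ}
    (hf : f ∈ monSpan p h {m | poleOrder p h m ≤ N}) :
    P.1.valuation f ^ p ≤ P.1.valuation (asX p h) ^ N := by
  induction hf using Submodule.span_induction with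
  | mem f hf =>
    obtain ⟨m, hm, rfl⟩ := hf
    rw [valuation_asMon hx]
    exact zpow_le_zpow_right₀ (one_lt_valuation_asX hx).le hm
  | zero => simp [hp.out.ne_zero]
  | add f g _ _ hf hg => exact valuation_pow_add_le hf hg
  | smul c f _ hf => exact (pow_le_pow_left₀ zero_le (valuation_smul_le c f) p).trans hf

theorem mem_monSpan_of_valuation_pow_le (hx : asX p h ∉ P.1) {f : ASField p h} {N : ℤ}
    {S : Set (ℤ × Fin p)} (hf : f ∈ monSpan p h S)
    (hle : P.1.valuation f ^ p ≤ P.1.valuation (asX p h) ^ N) :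
    f ∈ monSpan p h (S ∩ {m | poleOrder p h m ≤ N}) := by
  rw [monSpan, Finsupp.mem_span_image_iff_linearCombination] at hf
  obtain ⟨c, hc, rfl⟩ := hf
  refine Submodule.sum_mem _ fun m hm => Submodule.smul_mem _ _ (asMon_mem_monSpan ⟨hc hm, ?_⟩)
  have h1 := (pow_le_pow_left₀ zero_le (valuation_term_le hx c hm) p).trans hle
  rw [valuation_asMon hx] at h1
  exact (zpow_le_zpow_iff_right₀ (one_lt_valuation_asX hx)).1 h1

end Infinity

/-! ### Differentials at infinity -/

section FormsAtInfinity

variable {k : Type*} [Field k] {p : ℕ} {h : k[X]} [hp : Fact p.Prime] [CharP k p]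
  [hd : Fact (p.Coprime h.natDegree)] {P : Place k (ASField p h)}

omit hp in
theorem natCast_natDegree_ne_zero [hp : Fact p.Prime] : (h.natDegree : k) ≠ 0 := by
  rw [Ne, CharP.cast_eq_zero_iff k p]
  exact (Nat.Prime.coprime_iff_not_dvd hp.out).1 hd.out

include p in
theorem natDegree_derivative_and_ne_zero :
    derivative h ≠ 0 ∧ (derivative h).natDegree = h.natDegree - 1 := by
  have hd0 := natDegree_ne_zero_of_coprime p h
  have h1 : (derivative h).coeff (h.natDegree - 1) ≠ 0 := by
    rw [coeff_derivative, Nat.sub_add_cancel (Nat.one_le_iff_ne_zero.2 hd0)]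
    refine mul_ne_zero ?_ ?_
    · rw [coeff_natDegree, Ne, leadingCoeff_eq_zero]
      rintro rfl
      simp at hd0
    · have := natCast_natDegree_ne_zero (p := p) (h := h)
      rwa [← Nat.sub_add_cancel (Nat.one_le_iff_ne_zero.2 hd0), Nat.cast_add, Nat.cast_one] at this
  refine ⟨fun h0 => h1 (by rw [h0, coeff_zero]), le_antisymm (natDegree_derivative_le _) ?_⟩
  exact le_natDegree_of_ne_zero h1

theorem valuation_aeval_derivative (hx : asX p h ∉ P.1) :
    P.1.valuation (aeval (asX p h) (derivative h)) =
      P.1.valuation (asX p h) ^ ((h.natDegree : ℤ) - 1) := by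
  obtain ⟨h1, h2⟩ := natDegree_derivative_and_ne_zero (p := p) (h := h)
  have hd0 := natDegree_ne_zero_of_coprime p h
  rw [valuation_aeval_asX hx h1, h2, Nat.cast_sub (Nat.one_le_iff_ne_zero.2 hd0), Nat.cast_one]

theorem valuation_asDeriv_aeval_le (hx : asX p h ∉ P.1) {q : k[X]} :
    P.1.valuation (asDeriv p h (aeval (asX p h) q)) ≤
      P.1.valuation (asX p h) ^ ((q.natDegree : ℤ) - 1) := by
  rw [asDeriv_aeval]
  rcases eq_or_ne (derivative q) 0 with h0 | h0
  · rw [h0, map_zero, map_zero]; exact zero_le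
  · rw [valuation_aeval_asX hx h0]
    refine zpow_le_zpow_right₀ (one_lt_valuation_asX hx).le ?_
    have h1 := natDegree_derivative_le q
    have h2 : q.natDegree ≠ 0 := fun h2 => h0 (by
      rw [eq_C_of_natDegree_eq_zero h2, derivative_C])
    omega

/-- A nonzero element of `k(x)` has the value of a power `x ^ n` at infinity, and its derivative has
at most the value of `x ^ (n - 1)`. -/
theorem exists_valuation_algebraMap_eq (hx : asX p h ∉ P.1) {r : RatFunc k} (hr : r ≠ 0) :
    ∃ n : ℤ, P.1.valuation (algebraMap (RatFunc k) (ASField p h) r) =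
        P.1.valuation (asX p h) ^ n ∧
      P.1.valuation (asDeriv p h (algebraMap (RatFunc k) (ASField p h) r)) ≤
        P.1.valuation (asX p h) ^ (n - 1) := by
  have hw := zero_lt_one.trans (one_lt_valuation_asX hx)
  obtain ⟨a, b, hb, rfl⟩ := IsFractionRing.div_surjective (A := k[X]) r
  have hb0 := nonZeroDivisors.ne_zero hb
  have ha0 : a ≠ 0 := by rintro rfl; simp at hr
  have hc : algebraMap (RatFunc k) (ASField p h)
      (algebraMap k[X] (RatFunc k) a / algebraMap k[X] (RatFunc k) b) =
      aeval (asX p h) a / aeval (asX p h) b := by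
    rw [map_div₀, ← IsScalarTower.algebraMap_apply, ← IsScalarTower.algebraMap_apply,
      algebraMap_eq_aeval_asX, algebraMap_eq_aeval_asX]
  rw [hc]
  have hB := valuation_aeval_asX hx hb0
  have hA := valuation_aeval_asX hx ha0
  have hB0 : aeval (asX p h) b ≠ 0 := by
    rw [← Valuation.ne_zero_iff P.1.valuation, hB]
    exact zpow_ne_zero _ hw.ne'
  have hv : P.1.valuation (aeval (asX p h) a / aeval (asX p h) b) =
      P.1.valuation (asX p h) ^ ((a.natDegree : ℤ) - b.natDegree) := by
    rw [map_div₀, hA, hB, zpow_sub₀ hw.ne']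
  refine ⟨a.natDegree - b.natDegree, hv, ?_⟩
  set c := aeval (asX p h) a / aeval (asX p h) b with hcdef
  have h1 : c * aeval (asX p h) b = aeval (asX p h) a := div_mul_cancel₀ _ hB0
  have h2 := congrArg (asDeriv p h) h1
  rw [Derivation.leibniz, smul_eq_mul, smul_eq_mul] at h2
  have h3 : asDeriv p h c * aeval (asX p h) b =
      asDeriv p h (aeval (asX p h) a) - c * asDeriv p h (aeval (asX p h) b) := by
    rw [← h2]; ring
  have h4 : P.1.valuation (asDeriv p h c * aeval (asX p h) b) ≤
      P.1.valuation (asX p h) ^ ((a.natDegree : ℤ) - 1) := by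
    rw [h3]
    refine Valuation.map_sub_le _ (valuation_asDeriv_aeval_le hx) ?_
    rw [map_mul, hv]
    refine (mul_le_mul_right (valuation_asDeriv_aeval_le hx) _).trans ?_
    rw [← zpow_add₀ hw.ne']
    exact le_of_eq (by congr 1; ring)
  rw [map_mul, hB, ← le_div_iff₀ (zpow_pos hw _), ← zpow_sub₀ hw.ne'] at h4
  convert h4 using 2
  ring

omit [CharP k p] hd hp in
variable (p h) in
/-- The degree `2 g - 2 = p d - p - d - 1` of the canonical divisor, which is the order of the zero
of `dx` at infinity. -/
def canonicalDegree : ℤ := p * h.natDegree - p - h.natDegree - 1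

omit [CharP k p] in
include hp hd in
theorem neg_le_canonicalDegree : -(p : ℤ) ≤ canonicalDegree p h := by
  have h1 : (2 : ℤ) ≤ p := by exact_mod_cast hp.out.two_le
  have h2 : (1 : ℤ) ≤ h.natDegree := by
    exact_mod_cast Nat.one_le_iff_ne_zero.2 (natDegree_ne_zero_of_coprime p h)
  rw [canonicalDegree]
  nlinarith

theorem valuation_asDeriv_mul_asY_pow_le (hx : asX p h ∉ P.1) {c : ASField p h} {n : ℤ} {b : ℕ}
    (hb : b < p) (hc : P.1.valuation c = P.1.valuation (asX p h) ^ n)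
    (hc' : P.1.valuation (asDeriv p h c) ≤ P.1.valuation (asX p h) ^ (n - 1))
    (hn : p * n + b * h.natDegree ≤ 0) :
    P.1.valuation (asDeriv p h (c * asY p h ^ b)) ^ p ≤
      P.1.valuation (asX p h) ^ canonicalDegree p h := by
  have hw := one_lt_valuation_asX hx
  rw [Derivation.leibniz, smul_eq_mul, smul_eq_mul]
  refine valuation_pow_add_le ?_ ?_
  · rw [asDeriv_asY_pow]
    rcases Nat.eq_zero_or_pos b with rfl | hb0
    · simp [hp.out.ne_zero]
    have h1 : c * -((b : ASField p h) * aeval (asX p h) (derivative h) * asY p h ^ (b - 1)) =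
        (-b : k) • ((c * aeval (asX p h) (derivative h)) * asY p h ^ ((b : ℤ) - 1)) := by
      rw [Algebra.smul_def, map_neg, map_natCast, ← Nat.cast_pred hb0, zpow_natCast]
      ring
    rw [h1]
    refine (pow_le_pow_left₀ zero_le (valuation_smul_le _ _) p).trans ?_
    rw [valuation_mul_asY_zpow hx (n := n + (h.natDegree - 1))]
    · refine zpow_le_zpow_right₀ hw.le ?_
      -- `p n + b d` is not `0` since `p` does not divide `b d`
      have h2 : (p : ℤ) * n + b * h.natDegree ≠ 0 := by
        intro h0
        have h3 : (p : ℤ) ∣ (b : ℤ) * h.natDegree := ⟨-n, by linear_combination h0⟩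
        have h4 := IsCoprime.dvd_of_dvd_mul_right (Nat.isCoprime_iff_coprime.2 hd.out) h3
        exact Nat.not_dvd_of_pos_of_lt hb0 hb (by exact_mod_cast h4)
      have h3 : (p : ℤ) * n + b * h.natDegree ≤ -1 := by omega
      rw [canonicalDegree]
      linear_combination h3
    · rw [map_mul, hc, valuation_aeval_derivative hx, ← zpow_add₀ (zero_lt_one.trans hw).ne']
  · rw [mul_comm, ← zpow_natCast (asY p h)]
    refine (valuation_mul_asY_zpow_le hx hc' b).trans (zpow_le_zpow_right₀ hw.le ?_)
    have := neg_le_canonicalDegree (p := p) (h := h)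
    linear_combination hn + this

/-- A function that is regular at infinity is a sum of terms `c y ^ b` with `c` in `k(x)` which are
all regular at infinity, and the derivatives of these are explicit. -/
theorem valuation_asDeriv_pow_le (hx : asX p h ∉ P.1) {g : ASField p h} (hg : g ∈ P.1) :
    P.1.valuation (asDeriv p h g) ^ p ≤ P.1.valuation (asX p h) ^ canonicalDegree p h := by
  have hw := one_lt_valuation_asX hx
  let c : Fin (asPowerBasis p h).dim → RatFunc k := fun i => (asPowerBasis p h).basis.repr g i
  let f : Fin (asPowerBasis p h).dim → ASField p h := fun i =>
    algebraMap (RatFunc k) (ASField p h) (c i) * asY p h ^ (i : ℕ)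
  have hsum : g = ∑ i, f i := by
    conv_lhs => rw [← (asPowerBasis p h).basis.sum_repr g]
    refine Finset.sum_congr rfl fun i _ => ?_
    rw [PowerBasis.basis_eq_pow, asPowerBasis_gen, Algebra.smul_def]
  have hlt : ∀ i : Fin (asPowerBasis p h).dim, (i : ℕ) < p := fun i =>
    i.2.trans_eq (asPowerBasis_dim p h)
  have hval : ∀ i, c i ≠ 0 → ∃ n : ℤ, P.1.valuation (f i) ^ p =
        P.1.valuation (asX p h) ^ poleOrder p h (n, ⟨i, hlt i⟩) := fun i hi => by
    obtain ⟨n, hn, -⟩ := exists_valuation_algebraMap_eq hx hi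
    have h1 := valuation_mul_asY_zpow hx hn i
    rw [zpow_natCast] at h1
    exact ⟨n, h1⟩
  have hne : ∀ i, P.1.valuation (f i) ≠ 0 → c i ≠ 0 := fun i hi h0 => hi (by simp [f, h0])
  have hle : ∀ i, P.1.valuation (f i) ≤ 1 := fun i => by
    refine (Valuation.map_le_map_sum_of_injOn P.1.valuation (s := Finset.univ) (f := f)
      (fun i _ j _ h0 hij => ?_) (Finset.mem_univ i)).trans ?_
    · obtain ⟨n, hn⟩ := hval i (hne i h0)
      obtain ⟨n', hn'⟩ := hval j (hne j (hij ▸ h0))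
      rw [hij, hn'] at hn
      have h1 := poleOrder_injective (zpow_right_injective₀ (zero_lt_one.trans hw) hw.ne' hn)
      have h2 := congrArg (fun m : ℤ × Fin p => (m.2 : ℕ)) h1
      exact Fin.ext h2.symm
    · rw [← hsum]; exact (P.1.valuation_le_one_iff _).2 hg
  rw [hsum, map_sum]
  refine Finset.sum_induction _
    (fun t => P.1.valuation t ^ p ≤ P.1.valuation (asX p h) ^ canonicalDegree p h)
    (fun _ _ => valuation_pow_add_le) (by simp [hp.out.ne_zero]) fun i _ => ?_
  rcases eq_or_ne (c i) 0 with h0 | h0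
  · simp [f, h0, hp.out.ne_zero]
  obtain ⟨n, hn, hn'⟩ := exists_valuation_algebraMap_eq hx h0
  refine valuation_asDeriv_mul_asY_pow_le hx (hlt i) hn hn' ?_
  have h1 := valuation_mul_asY_zpow hx hn i
  rw [zpow_natCast] at h1
  have h2 := pow_le_one₀ zero_le (hle i) (n := p)
  rw [h1, ← zpow_zero (P.1.valuation (asX p h))] at h2
  exact (zpow_le_zpow_iff_right₀ hw).1 h2

/-- The bound on the derivatives of functions regular at infinity is attained, by the uniformizer
`x ^ m y ^ n` with `p m + n d = -1`. -/
theorem exists_valuation_asDeriv_pow_eq (hx : asX p h ∉ P.1) :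
    ∃ u ∈ P.1, P.1.valuation (asDeriv p h u) ^ p =
      P.1.valuation (asX p h) ^ canonicalDegree p h := by
  have hw := one_lt_valuation_asX hx
  obtain ⟨m, n, hmn⟩ : ∃ m n : ℤ, p * m + n * h.natDegree = -1 := by
    obtain ⟨a, b, hab⟩ := Nat.isCoprime_iff_coprime.2 hd.out
    exact ⟨-a, -b, by linear_combination -hab⟩
  refine ⟨asX p h ^ m * asY p h ^ n, ?_, ?_⟩
  · rw [← P.1.valuation_le_one_iff, ← pow_le_one_iff_of_nonneg zero_le hp.out.ne_zero,
      valuation_mul_asY_zpow hx (map_zpow₀ _ _ m), hmn]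
    rw [zpow_neg_one]
    exact inv_le_one_of_one_le₀ hw.le
  -- `p` does not divide `n`, as `p m + n d = -1`; so the term with `y'` survives and dominates
  have hn : (n : k) ≠ 0 := by
    rw [Ne, CharP.intCast_eq_zero_iff k p]
    rintro ⟨q, rfl⟩
    have h1 : (p : ℤ) ∣ 1 := ⟨-(m + q * h.natDegree), by linear_combination hmn⟩
    exact hp.out.one_lt.ne' (by exact_mod_cast Int.eq_one_of_dvd_one (by positivity) h1)
  have hder : asDeriv p h (asX p h ^ m * asY p h ^ n) =
      (m : k) • (asX p h ^ (m - 1) * asY p h ^ n) +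
      (-n : k) • (asX p h ^ m * aeval (asX p h) (derivative h) * asY p h ^ (n - 1)) := by
    rw [Derivation.leibniz, asDeriv_asX_zpow, Derivation.leibniz_zpow, asDeriv_asY,
      Algebra.smul_def (-n : k), Algebra.smul_def (m : k)]
    simp only [smul_eq_mul, map_neg, map_intCast, zsmul_eq_mul]
    ring
  have h1 : P.1.valuation
      ((m : k) • (asX p h ^ (m - 1) * asY p h ^ n)) ^ p ≤
      P.1.valuation (asX p h) ^ (-(p : ℤ) - 1) := by
    refine (pow_le_pow_left₀ zero_le (valuation_smul_le _ _) p).trans (le_of_eq ?_)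
    rw [valuation_mul_asY_zpow hx (map_zpow₀ _ _ _)]
    congr 1
    linear_combination hmn
  have h2 : P.1.valuation
      ((-n : k) • (asX p h ^ m * aeval (asX p h) (derivative h) * asY p h ^ (n - 1))) ^ p =
      P.1.valuation (asX p h) ^ canonicalDegree p h := by
    rw [valuation_smul (neg_ne_zero.2 hn), valuation_mul_asY_zpow hx (n := m + (h.natDegree - 1))]
    · congr 1
      rw [canonicalDegree]
      linear_combination hmn
    · rw [map_mul, map_zpow₀, valuation_aeval_derivative hx,
        ← zpow_add₀ (zero_lt_one.trans hw).ne']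
  rw [hder, Valuation.map_add_eq_of_lt_right, h2]
  refine lt_of_pow_lt_pow_left₀ p zero_le (h1.trans_lt ?_)
  rw [h2]
  refine zpow_lt_zpow_right₀ hw ?_
  have := neg_le_canonicalDegree (p := p) (h := h)
  omega

theorem smul_asDx_mem_regularFormsAt_iff_of_asX_notMem (hx : asX p h ∉ P.1) {f : ASField p h} :
    f • asDx p h ∈ regularFormsAt P ↔
      P.1.valuation f ^ p ≤ P.1.valuation (asX p h) ^ canonicalDegree p h := by
  rw [smul_asDx_mem_regularFormsAt_iff]
  constructor
  · intro hf
    induction hf using Submodule.span_induction with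
    | mem f hf =>
      obtain ⟨a, ha, b, hb, rfl⟩ := hf
      rw [map_mul, mul_pow]
      exact (mul_le_of_le_one_left zero_le (pow_le_one₀ zero_le
        ((P.1.valuation_le_one_iff _).2 ha))).trans (valuation_asDeriv_pow_le hx hb)
    | zero => simp [hp.out.ne_zero]
    | add f g _ _ hf hg => exact valuation_pow_add_le hf hg
    | smul c f _ hf => exact (pow_le_pow_left₀ zero_le (valuation_smul_le c f) p).trans hf
  · intro hf
    obtain ⟨u, hu, hu'⟩ := exists_valuation_asDeriv_pow_eq hx
    have hw := zero_lt_one.trans (one_lt_valuation_asX hx)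
    have h0 : asDeriv p h u ≠ 0 := by
      intro h0
      rw [h0, map_zero, zero_pow hp.out.ne_zero] at hu'
      exact zpow_ne_zero _ hw.ne' hu'.symm
    refine Submodule.subset_span ⟨f / asDeriv p h u, ?_, u, hu, (div_mul_cancel₀ f h0).symm⟩
    rw [← P.1.valuation_le_one_iff, ← pow_le_one_iff_of_nonneg zero_le hp.out.ne_zero, map_div₀,
      div_pow, hu']
    exact div_le_one_of_le₀ hf zero_le

end FormsAtInfinity

/-! ### Functions and forms on `U₁` and `U₂` -/

section Sections

variable {k : Type*} [Field k] {p : ℕ} {h : k[X]} [hp : Fact p.Prime] [CharP k p]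
  [hd : Fact (p.Coprime h.natDegree)]

theorem monSpan_le_place {P : Place k (ASField p h)} {S : Set (ℤ × Fin p)}
    (hP : ∀ m ∈ S, asMon p h m ∈ P.1) {f : ASField p h} (hf : f ∈ monSpan p h S) : f ∈ P.1 := by
  induction hf using Submodule.span_induction with
  | mem f hf => obtain ⟨m, hm, rfl⟩ := hf; exact hP m hm
  | zero => exact zero_mem _
  | add f g _ _ hf hg => exact add_mem hf hg
  | smul c f _ hf => rw [Algebra.smul_def]; exact mul_mem (P.2.1 c) hf

theorem mem_place_of_mem_monSpan_nonneg {P : Place k (ASField p h)} (hx : asX p h ∈ P.1)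
    {f : ASField p h} (hf : f ∈ monSpan p h {m | 0 ≤ m.1}) : f ∈ P.1 := by
  refine monSpan_le_place (fun m hm => mul_mem ?_ (pow_mem
    (mem_place_of_isIntegral hx (isIntegral_asY p h)) _)) hf
  obtain ⟨n, hn⟩ := Int.eq_ofNat_of_zero_le hm
  rw [hn, zpow_natCast]
  exact pow_mem hx n

theorem mem_place_of_mem_monSpan_univ {P : Place k (ASField p h)} (hx : asX p h ∈ P.1)
    (hx' : (asX p h)⁻¹ ∈ P.1) {f : ASField p h} (hf : f ∈ monSpan p h Set.univ) : f ∈ P.1 := by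
  refine monSpan_le_place (fun m hm => mul_mem ?_ (pow_mem
    (mem_place_of_isIntegral hx (isIntegral_asY p h)) _)) hf
  obtain ⟨n, hn | hn⟩ := Int.eq_nat_or_neg m.1
  · rw [hn, zpow_natCast]
    exact pow_mem hx n
  · rw [hn, zpow_neg, zpow_natCast, ← inv_pow]
    exact pow_mem hx' n

theorem inv_asX_mem {P : Place k (ASField p h)} (hx : asX p h ∉ P.1) : (asX p h)⁻¹ ∈ P.1 :=
  (P.1.mem_or_inv_mem _).resolve_left hx

theorem mem_regularFunctions_asU₂_iff {f : ASField p h} :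
    f ∈ regularFunctions (asU₂ p h) ↔ f ∈ monSpan p h {m | 0 ≤ m.1} :=
  ⟨fun hf => mem_monSpan_of_isIntegral (isIntegral_of_mem_regularFunctions hf),
    fun hf _ hP => mem_place_of_mem_monSpan_nonneg hP hf⟩

theorem mem_regularFunctions_inter_iff {f : ASField p h} :
    f ∈ regularFunctions (asU₁ p h ∩ asU₂ p h) ↔ f ∈ monSpan p h Set.univ :=
  ⟨mem_monSpan_of_mem_regularFunctions_inter,
    fun hf _ hP => mem_place_of_mem_monSpan_univ hP.2 hP.1 hf⟩

theorem mem_place_iff_valuation_pow_le {P : Place k (ASField p h)} {f : ASField p h} :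
    f ∈ P.1 ↔ P.1.valuation f ^ p ≤ P.1.valuation (asX p h) ^ (0 : ℤ) := by
  rw [zpow_zero, pow_le_one_iff_of_nonneg zero_le hp.out.ne_zero, P.1.valuation_le_one_iff]

theorem mem_regularFunctions_asU₁_iff {f : ASField p h} :
    f ∈ regularFunctions (asU₁ p h) ↔ f ∈ monSpan p h {m | poleOrder p h m ≤ 0} := by
  constructor
  · intro hf
    obtain ⟨P, hx⟩ := exists_place_asX_notMem p h
    have h1 := mem_regularFunctions_inter_iff.1 fun Q hQ => hf Q hQ.1
    have h2 := mem_monSpan_of_valuation_pow_le hx h1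
      (mem_place_iff_valuation_pow_le.1 (hf P (inv_asX_mem hx)))
    rwa [Set.univ_inter] at h2
  · intro hf P hP
    by_cases hx : asX p h ∈ P.1
    · exact mem_place_of_mem_monSpan_univ hx hP (monSpan_mono (Set.subset_univ _) hf)
    · exact mem_place_iff_valuation_pow_le.2 (valuation_pow_le_of_mem_monSpan hx hf)

omit [CharP k p] hp hd in
theorem mem_regularForms_iff {K : Type*} [Field K] [Algebra k K] {U : Set (Place k K)}
    {ω : Ω[K⁄k]} : ω ∈ regularForms U ↔ ∀ P ∈ U, ω ∈ regularFormsAt P := by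
  simp only [regularForms, Submodule.mem_iInf]

theorem smul_asDx_mem_regularForms_asU₂_iff {f : ASField p h} :
    f • asDx p h ∈ regularForms (asU₂ p h) ↔ f ∈ monSpan p h {m | 0 ≤ m.1} := by
  rw [← mem_regularFunctions_asU₂_iff, mem_regularForms_iff]
  exact forall₂_congr fun P hP => smul_asDx_mem_regularFormsAt_iff_of_asX_mem hP

theorem smul_asDx_mem_regularForms_asU₁_iff {f : ASField p h} :
    f • asDx p h ∈ regularForms (asU₁ p h) ↔
      f ∈ monSpan p h {m | poleOrder p h m ≤ canonicalDegree p h} := by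
  rw [mem_regularForms_iff]
  constructor
  · intro hf
    obtain ⟨P, hx⟩ := exists_place_asX_notMem p h
    have h1 := mem_regularFunctions_inter_iff.1 fun Q hQ =>
      (smul_asDx_mem_regularFormsAt_iff_of_asX_mem hQ.2).1 (hf Q hQ.1)
    have h2 := mem_monSpan_of_valuation_pow_le hx h1
      ((smul_asDx_mem_regularFormsAt_iff_of_asX_notMem hx).1 (hf P (inv_asX_mem hx)))
    rwa [Set.univ_inter] at h2
  · intro hf P hP
    by_cases hx : asX p h ∈ P.1
    · rw [smul_asDx_mem_regularFormsAt_iff_of_asX_mem hx]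
      exact mem_place_of_mem_monSpan_univ hx hP (monSpan_mono (Set.subset_univ _) hf)
    · rw [smul_asDx_mem_regularFormsAt_iff_of_asX_notMem hx]
      exact valuation_pow_le_of_mem_monSpan hx hf

end Sections

/-! ### Exponents -/

section Indices

variable {k : Type*} [Field k] {p : ℕ} {h : k[X]} [hp : Fact p.Prime]
  [hd : Fact (p.Coprime h.natDegree)]

theorem add_two_le_iff (i j : ℕ) :
    p * i + j * h.natDegree + 2 ≤ (p - 1) * (h.natDegree - 1) ↔
      (p * i + j * h.natDegree : ℤ) ≤ canonicalDegree p h := by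
  have h1 := hp.out.one_lt.le
  have h2 := Nat.one_le_iff_ne_zero.2 (natDegree_ne_zero_of_coprime p h)
  zify [h1, h2]
  rw [canonicalDegree]
  constructor <;> intro h3 <;> linear_combination h3

theorem ASIndex.le (ij : ASIndex p h) :
    (p * ij.1.1 + ij.1.2 * h.natDegree : ℤ) ≤ canonicalDegree p h :=
  (add_two_le_iff _ _).1 ij.2

theorem lt_of_le_canonicalDegree {i j : ℤ} (hi : 0 ≤ i)
    (hij : p * i + j * h.natDegree ≤ canonicalDegree p h) : j + 1 < p := by
  by_contra! hcon
  have h1 : (1 : ℤ) ≤ h.natDegree := by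
    exact_mod_cast Nat.one_le_iff_ne_zero.2 (natDegree_ne_zero_of_coprime p h)
  have h2 : (0 : ℤ) ≤ p * i := by positivity
  have h3 : (2 : ℤ) ≤ p := by exact_mod_cast hp.out.two_le
  rw [canonicalDegree] at hij
  nlinarith

theorem ASIndex.lt (ij : ASIndex p h) : ij.1.2 + 1 < p := by
  exact_mod_cast lt_of_le_canonicalDegree (by positivity) ij.le

/-- The exponents `(i, j)` of the coefficient of `α_{i,j}`. -/
def alphaExp (ij : ASIndex p h) : ℤ × Fin p := (ij.1.1, ⟨ij.1.2, by have := ij.lt; omega⟩)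

/-- The exponents `(-(i + 1), p - 1 - j)` of the function in `β_{i,j}`. -/
def betaExp (ij : ASIndex p h) : ℤ × Fin p :=
  (-(ij.1.1 + 1), ⟨p - 1 - ij.1.2, by have := ij.lt; omega⟩)

theorem alphaExp_injective : Function.Injective (alphaExp (p := p) (h := h)) := by
  rintro ⟨⟨i, j⟩, h1⟩ ⟨⟨i', j'⟩, h2⟩ heq
  simp only [alphaExp, Prod.mk.injEq, Fin.mk.injEq] at heq
  ext <;> simp <;> omega

theorem betaExp_injective : Function.Injective (betaExp (p := p) (h := h)) := by
  intro ij ij' heq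
  have h1 := ij.lt
  have h2 := ij'.lt
  simp only [betaExp, Prod.mk.injEq, Fin.mk.injEq] at heq
  ext <;> omega

theorem range_alphaExp : Set.range (alphaExp (p := p) (h := h)) =
    {m | 0 ≤ m.1} ∩ {m | poleOrder p h m ≤ canonicalDegree p h} := by
  ext ⟨a, b⟩
  constructor
  · rintro ⟨ij, hij⟩
    rw [← hij]
    exact ⟨Int.natCast_nonneg _, ij.le⟩
  · rintro ⟨h1, h2⟩
    obtain ⟨i, rfl⟩ := Int.eq_ofNat_of_zero_le h1
    exact ⟨⟨(i, b), (add_two_le_iff _ _).2 h2⟩, rfl⟩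

/-- The monomials of the `β_{i,j}` are those regular neither on `U₁` nor on `U₂`. -/
theorem range_betaExp : Set.range (betaExp (p := p) (h := h)) =
    ({m | poleOrder p h m ≤ 0} ∪ {m | 0 ≤ m.1})ᶜ := by
  ext ⟨a, b⟩
  simp only [Set.mem_compl_iff, Set.mem_union, Set.mem_ofPred_eq, not_or, not_le, poleOrder]
  constructor
  · rintro ⟨ij, hij⟩
    rw [betaExp, Prod.mk.injEq] at hij
    obtain ⟨rfl, rfl⟩ := hij
    have h1 := ij.le
    have h2 := ij.lt
    rw [canonicalDegree] at h1
    refine ⟨?_, by omega⟩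
    have h3 : ((p - 1 - ij.1.2 : ℕ) : ℤ) = p - 1 - ij.1.2 := by omega
    rw [h3]
    linear_combination h1
  · rintro ⟨h1, h2⟩
    obtain ⟨i, hi⟩ := Int.eq_ofNat_of_zero_le (a := -a - 1) (by omega)
    have hb := b.2
    refine ⟨⟨(i, p - 1 - b), (add_two_le_iff _ _).2 ?_⟩, ?_⟩
    · have h3 : ((p - 1 - b : ℕ) : ℤ) = p - 1 - b := by omega
      simp only [h3, canonicalDegree]
      rw [← hi]
      linear_combination Int.add_one_le_iff.2 h1
    · simp only [betaExp, Prod.mk.injEq]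
      exact ⟨by omega, Fin.ext (by simp; omega)⟩

theorem nonneg_inter_poleOrder_nonpos :
    {m | 0 ≤ m.1} ∩ {m | poleOrder p h m ≤ 0} ⊆ {((0 : ℤ), (⟨0, hp.out.pos⟩ : Fin p))} := by
  rintro ⟨a, b⟩ ⟨h1, h2⟩
  simp only [Set.mem_ofPred_eq, poleOrder] at h1 h2
  have h3 : (1 : ℤ) ≤ h.natDegree := by
    exact_mod_cast Nat.one_le_iff_ne_zero.2 (natDegree_ne_zero_of_coprime p h)
  have h4 : (1 : ℤ) ≤ p := by exact_mod_cast hp.out.one_lt.le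
  have h5 : 0 ≤ (b : ℤ) := by positivity
  have h6 : a = 0 := by nlinarith
  have h7 : (b : ℤ) = 0 := by nlinarith
  rw [Set.mem_singleton_iff, Prod.mk.injEq]
  exact ⟨h6, Fin.ext (Int.natCast_eq_zero.1 h7)⟩

end Indices

/-! ### Bases of quotients -/

section LinearAlgebra

/-- Two families in `Z` that together are independent modulo `B` and span `Z` modulo `B` give a
basis of `Z / B`. -/
theorem exists_basis_quotient_submoduleOf {R V ι κ : Type*} [Ring R] [AddCommGroup V] [Module R V]
    (Z B : Submodule R V) {v : ι → V} {w : κ → V} (hv : ∀ i, v i ∈ Z) (hw : ∀ i, w i ∈ Z)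
    (hli : ∀ (a : ι →₀ R) (b : κ →₀ R),
      Finsupp.linearCombination R v a + Finsupp.linearCombination R w b ∈ B → a = 0 ∧ b = 0)
    (hsp : ∀ z ∈ Z, ∃ s ∈ Submodule.span R (Set.range v), ∃ t ∈ Submodule.span R (Set.range w),
      z - (s + t) ∈ B) :
    ∃ b : Module.Basis (ι ⊕ κ) R (Z ⧸ B.submoduleOf Z),
      (∀ i, b (Sum.inl i) = Submodule.Quotient.mk ⟨v i, hv i⟩) ∧
        ∀ i, b (Sum.inr i) = Submodule.Quotient.mk ⟨w i, hw i⟩ := by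
  let u : ι ⊕ κ → Z := Sum.elim (fun i => ⟨v i, hv i⟩) (fun i => ⟨w i, hw i⟩)
  let q : Z →ₗ[R] Z ⧸ B.submoduleOf Z := (B.submoduleOf Z).mkQ
  have hv' : (Z.subtype ∘ u) ∘ Sum.inl = v := rfl
  have hw' : (Z.subtype ∘ u) ∘ Sum.inr = w := rfl
  have hli' : LinearIndependent R (q ∘ u) := by
    rw [linearIndependent_iff]
    intro c hc
    rw [← Finsupp.apply_linearCombination, Submodule.mkQ_apply, Submodule.Quotient.mk_eq_zero,
      Submodule.submoduleOf, Submodule.mem_comap, Finsupp.apply_linearCombination,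
      ← Finsupp.comapDomain_sumElim_comapDomain c, Finsupp.sumElim_eq_add, map_add,
      Finsupp.linearCombination_mapDomain, Finsupp.linearCombination_mapDomain, hv', hw'] at hc
    obtain ⟨h1, h2⟩ := hli _ _ hc
    rw [← Finsupp.comapDomain_sumElim_comapDomain c, h1, h2, Finsupp.sumElim_zero_zero]
  have hsp' : ⊤ ≤ Submodule.span R (Set.range (q ∘ u)) := by
    rintro z -
    obtain ⟨⟨z, hz⟩, rfl⟩ := Submodule.Quotient.mk_surjective _ z
    obtain ⟨s, hs, t, ht, hst⟩ := hsp z hz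
    have hle : Submodule.span R (Set.range v) ⊔ Submodule.span R (Set.range w) ≤
        (Submodule.span R (Set.range u)).map Z.subtype := by
      rw [Submodule.map_span, ← Set.range_comp]
      refine sup_le (Submodule.span_mono ?_) (Submodule.span_mono ?_)
      · rintro _ ⟨i, rfl⟩; exact ⟨Sum.inl i, rfl⟩
      · rintro _ ⟨i, rfl⟩; exact ⟨Sum.inr i, rfl⟩
    obtain ⟨y, hy, hyst⟩ := hle (Submodule.add_mem_sup hs ht)
    have h1 : (Submodule.Quotient.mk ⟨z, hz⟩ : Z ⧸ B.submoduleOf Z) = q y := by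
      refine (Submodule.Quotient.eq _).2 ?_
      change z - Z.subtype y ∈ B
      rwa [hyst]
    rw [h1, Set.range_comp, ← Submodule.map_span]
    exact Submodule.mem_map_of_mem hy
  exact ⟨Module.Basis.mk hli' hsp', fun i => Module.Basis.mk_apply _ _ _,
    fun i => Module.Basis.mk_apply _ _ _⟩

end LinearAlgebra

/-! ### Cocycles and coboundaries -/

section Cocycles

variable {k : Type*} [Field k] {p : ℕ} {h : k[X]} [hp : Fact p.Prime] [CharP k p]
  [hd : Fact (p.Coprime h.natDegree)]

variable (p h) in
/-- The linear map `f ↦ (0, f dx, f dx)`. -/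
def formPair : ASField p h →ₗ[k] ASField p h × Ω[ASField p h⁄k] × Ω[ASField p h⁄k] where
  toFun f := (0, f • asDx p h, f • asDx p h)
  map_add' f g := by simp [add_smul]
  map_smul' c f := by simp

theorem formPair_injective : Function.Injective (formPair p h) := by
  intro f g hfg
  have h1 := congrArg (fun z => kaehlerEquiv p h z.2.1) hfg
  simpa only [formPair, LinearMap.coe_mk, AddHom.coe_mk, kaehlerEquiv_smul_asDx] using h1

theorem alphaTriple_eq (ij : ASIndex p h) :
    alphaTriple p h ij.1.1 ij.1.2 = formPair p h (asMon p h (alphaExp ij)) := by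
  simp only [alphaTriple, formPair, LinearMap.coe_mk, AddHom.coe_mk, asMon, alphaExp, zpow_natCast]

theorem formPair_mem_deRhamCocycles_iff {f : ASField p h} :
    formPair p h f ∈ deRhamCocycles (asU₁ p h) (asU₂ p h) ↔
      f ∈ monSpan p h (Set.range (alphaExp (p := p) (h := h))) := by
  constructor
  · rintro ⟨-, h1, h2, -⟩
    obtain ⟨P, hx⟩ := exists_place_asX_notMem p h
    rw [range_alphaExp]
    exact mem_monSpan_of_valuation_pow_le hx (smul_asDx_mem_regularForms_asU₂_iff.1 h2)
      (valuation_pow_le_of_mem_monSpan hx (smul_asDx_mem_regularForms_asU₁_iff.1 h1))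
  · intro hf
    rw [range_alphaExp] at hf
    exact ⟨zero_mem _,
      smul_asDx_mem_regularForms_asU₁_iff.2 (monSpan_mono Set.inter_subset_right hf),
      smul_asDx_mem_regularForms_asU₂_iff.2 (monSpan_mono Set.inter_subset_left hf),
      by simp [formPair]⟩

theorem alphaTriple_mem (ij : ASIndex p h) :
    alphaTriple p h ij.1.1 ij.1.2 ∈ deRhamCocycles (asU₁ p h) (asU₂ p h) := by
  rw [alphaTriple_eq, formPair_mem_deRhamCocycles_iff]
  exact asMon_mem_monSpan ⟨ij, rfl⟩

theorem betaTriple_fst (n : ℕ) (ij : ASIndex p h) :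
    (betaTriple p h n ij.1.1 ij.1.2).1 = asMon p h (betaExp ij) := by
  have h1 : asX p h ^ (-((ij.1.1 : ℤ) + 1)) = (asX p h ^ (ij.1.1 + 1))⁻¹ := by
    rw [zpow_neg]; norm_cast
  simp only [betaTriple, asMon, betaExp, h1]
  rw [div_eq_mul_inv, mul_comm]

omit [CharP k p] hp hd in
theorem lowPart_add_highPart (s : k[X]) (n : ℕ) : lowPart s n + highPart s n = s := by
  rw [lowPart, highPart]
  simp only [← not_le]
  rw [Finset.sum_filter_add_sum_filter_not]
  exact s.sum_monomial_eq

/-- A sum of terms `c_m x ^ m`, multiplied by `y ^ b / x ^ a`, in terms of monomials. -/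
theorem aeval_sum_monomial_mul_mem_monSpan {T : Finset ℕ} (s : ℕ → k) (a : ℕ) (b : Fin p)
    {S : Set (ℤ × Fin p)} (hS : ∀ m ∈ T, ((m : ℤ) - a, b) ∈ S) :
    aeval (asX p h) (∑ m ∈ T, monomial m (s m)) * asY p h ^ (b : ℕ) / asX p h ^ a ∈
      monSpan p h S := by
  rw [map_sum, Finset.sum_mul, Finset.sum_div]
  refine Submodule.sum_mem _ fun m hm => ?_
  have h1 : aeval (asX p h) (monomial m (s m)) * asY p h ^ (b : ℕ) / asX p h ^ a =
      s m • asMon p h ((m : ℤ) - a, b) := by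
    rw [aeval_monomial, asMon, zpow_sub₀ (asX_ne_zero p h), Algebra.smul_def, zpow_natCast,
      zpow_natCast]
    ring
  rw [h1]
  exact Submodule.smul_mem _ _ (asMon_mem_monSpan (hS m hm))

theorem natCast_mul_mem_monSpan {S : Set (ℤ × Fin p)} {f : ASField p h} (n : ℕ)
    (hf : f ∈ monSpan p h S) : (n : ASField p h) * f ∈ monSpan p h S := by
  rw [← nsmul_eq_mul]
  exact nsmul_mem hf n

/-- The lower bound on the cut-off makes the second form regular at `x = 0`, the upper bound makes
the first one regular at infinity. -/
theorem betaTriple_mem (n : ℕ) (ij : ASIndex p h) (hn : ij.1.1 + 1 ≤ n)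
    (hn' : p * n + 1 ≤ p * (ij.1.1 + 1) + h.natDegree) :
    betaTriple p h n ij.1.1 ij.1.2 ∈ deRhamCocycles (asU₁ p h) (asU₂ p h) := by
  have hlt := ij.lt
  have hx0 := asX_ne_zero p h
  have hfst := betaTriple_fst n ij
  obtain ⟨⟨i, j⟩, hij⟩ := ij
  simp only at hlt hn hn' hfst ⊢
  have hd1 : (1 : ℤ) ≤ h.natDegree := by
    exact_mod_cast Nat.one_le_iff_ne_zero.2 (natDegree_ne_zero_of_coprime p h)
  have hp1 : (1 : ℤ) ≤ p := by exact_mod_cast hp.out.one_lt.le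
  have hj : (0 : ℤ) ≤ j * h.natDegree := by positivity
  have hi : (0 : ℤ) ≤ p * i := by positivity
  have hb1 : ((p - 1 - j : ℕ) : ℤ) = p - 1 - j := by omega
  have hb2 : ((p - 2 - j : ℕ) : ℤ) = p - 2 - j := by omega
  refine ⟨?_, ?_, ?_, ?_⟩
  · rw [hfst, mem_regularFunctions_inter_iff]
    exact asMon_mem_monSpan (Set.mem_univ _)
  · refine smul_asDx_mem_regularForms_asU₁_iff.2 (neg_mem ?_)
    rw [add_div]
    refine add_mem ?_ ?_
    · rw [mul_assoc, mul_div_assoc]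
      refine natCast_mul_mem_monSpan _ ?_
      refine aeval_sum_monomial_mul_mem_monSpan _ (i + 2) ⟨p - 2 - j, by omega⟩ fun m hm => ?_
      have hm' : (p : ℤ) * m ≤ p * n := by
        exact_mod_cast Nat.mul_le_mul_left p (Finset.mem_filter.1 hm).2
      zify at hn'
      simp only [Set.mem_ofPred_eq, poleOrder, canonicalDegree, hb2]
      push_cast
      linear_combination hm' + hn' + hj
    · rw [mul_div_assoc]
      refine natCast_mul_mem_monSpan _ ?_
      have h1 := asMon_mem_monSpan (h := h)
        (S := {m | poleOrder p h m ≤ canonicalDegree p h})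
        (m := (-((i + 2 : ℕ) : ℤ), ⟨p - 1 - j, by omega⟩)) (by
          simp only [Set.mem_ofPred_eq, poleOrder, canonicalDegree, hb1]
          push_cast
          linear_combination hi + hj + hp1)
      rwa [asMon, zpow_neg, zpow_natCast, mul_comm, ← div_eq_mul_inv] at h1
  · refine smul_asDx_mem_regularForms_asU₂_iff.2 ?_
    rw [mul_assoc, mul_div_assoc]
    refine natCast_mul_mem_monSpan _ ?_
    refine aeval_sum_monomial_mul_mem_monSpan _ (i + 2) ⟨p - 2 - j, by omega⟩ fun m hm => ?_
    have hm' := (Finset.mem_filter.1 hm).2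
    simp only [Set.mem_ofPred_eq]
    push_cast
    omega
  · rw [D_eq_asDeriv_smul]
    simp only [betaTriple]
    rw [← sub_smul]
    congr 1
    have hs : aeval (asX p h) (lowPart (X * derivative h) n) +
        aeval (asX p h) (highPart (X * derivative h) n) =
        asX p h * aeval (asX p h) (derivative h) := by
      rw [← map_add, lowPart_add_highPart, map_mul, aeval_X]
    have hpow : asX p h ^ (-((i + 1 : ℕ) : ℤ) - 1) = (asX p h ^ (i + 2))⁻¹ := by
      rw [← zpow_natCast _ (i + 2), ← zpow_neg]
      congr 1
    have h1 : asDeriv p h (asY p h ^ (p - 1 - j) / asX p h ^ (i + 1)) =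
        -(((p - 1 - j : ℕ) : ASField p h) * (asX p h * aeval (asX p h) (derivative h)) *
          asY p h ^ (p - 2 - j) / asX p h ^ (i + 2)) -
        ((i + 1 : ℕ) : ASField p h) * asY p h ^ (p - 1 - j) / asX p h ^ (i + 2) := by
      have h2 : p - 1 - j - 1 = p - 2 - j := by omega
      rw [div_eq_mul_inv, ← zpow_natCast _ (i + 1), ← zpow_neg, Derivation.leibniz,
        asDeriv_asX_zpow, asDeriv_asY_pow, hpow, zpow_neg, zpow_natCast, h2, smul_eq_mul,
        smul_eq_mul]
      push_cast
      field_simp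
      ring
    rw [h1, ← hs]
    ring

theorem deRhamCoboundaries_le {k K : Type*} [Field k] [Field K] [Algebra k K]
    {U₁ U₂ : Set (Place k K)} : deRhamCoboundaries U₁ U₂ ≤ deRhamCocycles U₁ U₂ := by
  have hD : ∀ {U : Set (Place k K)} {t : K}, t ∈ regularFunctions U →
      KaehlerDifferential.D k K t ∈ regularForms U := fun ht =>
    mem_regularForms_iff.2 fun P hP =>
      Submodule.subset_span ⟨1, one_mem _, _, ht P hP, (one_smul _ _).symm⟩
  rintro _ ⟨t₁, ht₁, t₂, ht₂, rfl⟩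
  exact ⟨sub_mem (fun P hP => ht₁ P hP.1) fun P hP => ht₂ P hP.2, hD ht₁, hD ht₂, map_sub _ _ _⟩

/-- A function that is regular on both `U₁` and `U₂` is constant. -/
theorem D_eq_zero_of_mem_monSpan {t : ASField p h}
    (ht : t ∈ monSpan p h ({m | 0 ≤ m.1} ∩ {m | poleOrder p h m ≤ 0})) :
    KaehlerDifferential.D k (ASField p h) t = 0 := by
  induction ht using Submodule.span_induction with
  | mem f hf =>
    obtain ⟨m, hm, rfl⟩ := hf
    rw [Set.mem_singleton_iff.1 (nonneg_inter_poleOrder_nonpos hm)]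
    simp [asMon]
  | zero => exact map_zero _
  | add f g _ _ hf hg => rw [map_add, hf, hg, add_zero]
  | smul c f _ hf => rw [Derivation.map_smul, hf, smul_zero]

theorem span_alphaTriple :
    Submodule.span k (Set.range fun ij : ASIndex p h => alphaTriple p h ij.1.1 ij.1.2) =
      (monSpan p h (Set.range (alphaExp (p := p) (h := h)))).map (formPair p h) := by
  rw [monSpan, Submodule.map_span, ← Set.range_comp, ← Set.range_comp]
  congr 2
  exact funext alphaTriple_eq

/-- For any cut-off `n` that makes the `β` triples cocycles, the classes of the `α` and `β` triples
form a basis: only the first components of the `β` triples matter. -/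
theorem exists_basis_deRhamH1 (n : ASIndex p h → ℕ)
    (hβ : ∀ ij, betaTriple p h (n ij) ij.1.1 ij.1.2 ∈ deRhamCocycles (asU₁ p h) (asU₂ p h)) :
    ∃ b : Module.Basis (ASIndex p h ⊕ ASIndex p h) k (DeRhamH1 (asU₁ p h) (asU₂ p h)),
      (∀ ij, b (Sum.inl ij) = deRhamClass (alphaTriple_mem ij)) ∧
        ∀ ij, b (Sum.inr ij) = deRhamClass (hβ ij) := by
  have hfst : ∀ c : ASIndex p h →₀ k, (Finsupp.linearCombination k
      (fun ij : ASIndex p h => betaTriple p h (n ij) ij.1.1 ij.1.2) c).1 =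
      Finsupp.linearCombination k (asMon p h ∘ betaExp) c := fun c => by
    have h1 := Finsupp.apply_linearCombination k
      (LinearMap.fst k (ASField p h) (Ω[ASField p h⁄k] × Ω[ASField p h⁄k]))
      (fun ij : ASIndex p h => betaTriple p h (n ij) ij.1.1 ij.1.2) c
    rw [LinearMap.fst_apply] at h1
    rw [h1]
    congr 2
    exact funext fun ij => betaTriple_fst (n ij) ij
  have halpha : ∀ c : ASIndex p h →₀ k, Finsupp.linearCombination k
      (fun ij : ASIndex p h => alphaTriple p h ij.1.1 ij.1.2) c =
      formPair p h (Finsupp.linearCombination k (asMon p h ∘ alphaExp) c) := fun c => by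
    rw [Finsupp.apply_linearCombination]
    congr 2
    exact funext alphaTriple_eq
  have hlin := linearIndependent_asMon p h
  refine exists_basis_quotient_submoduleOf _ _ alphaTriple_mem hβ (fun a b hab => ?_)
    fun z hz => ?_
  · obtain ⟨t₁, ht₁, t₂, ht₂, heq⟩ := hab
    rw [mem_regularFunctions_asU₁_iff] at ht₁
    rw [mem_regularFunctions_asU₂_iff] at ht₂
    -- the two sides have no monomial in common, so both vanish
    have h1 : Finsupp.linearCombination k (asMon p h ∘ betaExp) b = t₁ - t₂ := by
      rw [← hfst]
      have := congrArg Prod.fst heq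
      rw [halpha] at this
      simpa [formPair] using this
    have h2 : Finsupp.linearCombination k (asMon p h ∘ betaExp) b ∈
        monSpan p h (Set.range (betaExp (p := p) (h := h))) := by
      rw [monSpan, ← Set.range_comp]
      exact Finsupp.mem_span_range_iff_exists_finsupp.2 ⟨b, rfl⟩
    have h3 : t₁ - t₂ ∈ monSpan p h ({m | poleOrder p h m ≤ 0} ∪ {m | 0 ≤ m.1}) :=
      sub_mem (monSpan_mono Set.subset_union_left ht₁) (monSpan_mono Set.subset_union_right ht₂)
    have h4 : t₁ - t₂ = 0 := by
      have hdis : Disjoint (monSpan p h (Set.range (betaExp (p := p) (h := h))))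
          (monSpan p h ({m | poleOrder p h m ≤ 0} ∪ {m | 0 ≤ m.1})) := by
        refine hlin.disjoint_span_image ?_
        rw [range_betaExp]
        exact disjoint_compl_left
      exact Submodule.disjoint_def.1 hdis _ (h1 ▸ h2) h3
    have hb : b = 0 :=
      linearIndependent_iff.1 (hlin.comp _ betaExp_injective) b (h1.trans h4)
    subst hb
    refine ⟨?_, rfl⟩
    obtain rfl := sub_eq_zero.1 h4
    obtain ⟨P, hx⟩ := exists_place_asX_notMem p h
    have h5 := D_eq_zero_of_mem_monSpan (mem_monSpan_of_valuation_pow_le hx ht₂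
      (valuation_pow_le_of_mem_monSpan hx ht₁))
    rw [h5, map_zero, add_zero, sub_self, halpha] at heq
    refine linearIndependent_iff.1 (hlin.comp _ alphaExp_injective) a (formPair_injective ?_)
    rw [heq, map_zero]
    rfl
  · have ht := mem_regularFunctions_inter_iff.1 hz.1
    rw [← Set.compl_union_self ({m | poleOrder p h m ≤ 0} ∪ {m | 0 ≤ m.1}), ← range_betaExp,
      monSpan, Set.image_union, Set.image_union, Submodule.span_union, Submodule.span_union] at ht
    obtain ⟨s, hs, t, ht, hst⟩ := Submodule.mem_sup.1 ht
    obtain ⟨t₁, ht₁, t₂, ht₂, rfl⟩ := Submodule.mem_sup.1 ht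
    rw [← Set.range_comp, Finsupp.mem_span_range_iff_exists_finsupp] at hs
    obtain ⟨c, hc⟩ := hs
    let w := Finsupp.linearCombination k
      (fun ij : ASIndex p h => betaTriple p h (n ij) ij.1.1 ij.1.2) c
    have hwspan : w ∈ Submodule.span k (Set.range
        fun ij : ASIndex p h => betaTriple p h (n ij) ij.1.1 ij.1.2) :=
      Finsupp.mem_span_range_iff_exists_finsupp.2 ⟨c, rfl⟩
    have hwZ : w ∈ deRhamCocycles (asU₁ p h) (asU₂ p h) := by
      refine Submodule.span_le.2 ?_ hwspan
      rintro _ ⟨ij, rfl⟩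
      exact hβ ij
    have hw1 : w.1 = s := (hfst c).trans hc
    -- the coboundary of `(t₁, -t₂)` has first component `t₁ + t₂`
    let e : ASField p h × Ω[ASField p h⁄k] × Ω[ASField p h⁄k] :=
      (t₁ - -t₂, KaehlerDifferential.D k (ASField p h) t₁,
        KaehlerDifferential.D k (ASField p h) (-t₂))
    have heB : e ∈ deRhamCoboundaries (asU₁ p h) (asU₂ p h) :=
      ⟨t₁, mem_regularFunctions_asU₁_iff.2 ht₁, -t₂,
        neg_mem (mem_regularFunctions_asU₂_iff.2 ht₂), rfl⟩
    have hZ : z - w - e ∈ deRhamCocycles (asU₁ p h) (asU₂ p h) :=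
      sub_mem (sub_mem hz hwZ) (deRhamCoboundaries_le heB)
    have h1 : (z - w - e).1 = 0 := by
      rw [Prod.fst_sub, Prod.fst_sub, hw1, ← hst]
      simp only [e]
      ring
    have h2 : z - w - e = formPair p h (kaehlerEquiv p h (z - w - e).2.1) := by
      have h3 := hZ.2.2.2
      rw [h1, map_zero, eq_comm, sub_eq_zero] at h3
      simp only [formPair, LinearMap.coe_mk, AddHom.coe_mk, kaehlerEquiv_smul_asDx_self]
      exact Prod.ext h1 (Prod.ext rfl h3.symm)
    refine ⟨z - w - e, ?_, w, hwspan, ?_⟩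
    · rw [span_alphaTriple, h2]
      rw [h2, formPair_mem_deRhamCocycles_iff] at hZ
      exact Submodule.mem_map_of_mem hZ
    · convert heB using 1
      abel

end Cocycles

end

theorem proposition2p4 {k : Type*} [Field k] [IsAlgClosed k] (p : ℕ) [Fact p.Prime] [CharP k p]
    (h : k[X]) [Fact (p.Coprime h.natDegree)] :
    -- the cutoff `i + 1`
    (∃ (hα : ∀ ij : ASIndex p h,
          alphaTriple p h ij.1.1 ij.1.2 ∈ deRhamCocycles (asU₁ p h) (asU₂ p h))
        (hβ : ∀ ij : ASIndex p h,
          betaTriple p h (ij.1.1 + 1) ij.1.1 ij.1.2 ∈ deRhamCocycles (asU₁ p h) (asU₂ p h))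
        (b : Module.Basis (ASIndex p h ⊕ ASIndex p h) k (DeRhamH1 (asU₁ p h) (asU₂ p h))),
      (∀ ij, b (Sum.inl ij) = deRhamClass (hα ij)) ∧
        ∀ ij, b (Sum.inr ij) = deRhamClass (hβ ij)) ∧
    -- the cutoff `i + 2`, for `d ≥ p + 1`
    (p + 1 ≤ h.natDegree →
      ∃ (hα : ∀ ij : ASIndex p h,
          alphaTriple p h ij.1.1 ij.1.2 ∈ deRhamCocycles (asU₁ p h) (asU₂ p h))
        (hβ : ∀ ij : ASIndex p h,
          betaTriple p h (ij.1.1 + 2) ij.1.1 ij.1.2 ∈ deRhamCocycles (asU₁ p h) (asU₂ p h))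
        (b : Module.Basis (ASIndex p h ⊕ ASIndex p h) k (DeRhamH1 (asU₁ p h) (asU₂ p h))),
      (∀ ij, b (Sum.inl ij) = deRhamClass (hα ij)) ∧
        ∀ ij, b (Sum.inr ij) = deRhamClass (hβ ij)) := by
  refine ⟨?_, fun hdp => ?_⟩
  · have hβ : ∀ ij : ASIndex p h,
        betaTriple p h (ij.1.1 + 1) ij.1.1 ij.1.2 ∈ deRhamCocycles (asU₁ p h) (asU₂ p h) :=
      fun ij => betaTriple_mem _ ij le_rfl
        (Nat.add_le_add_left (Nat.one_le_iff_ne_zero.2 (natDegree_ne_zero_of_coprime p h)) _)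
    exact ⟨alphaTriple_mem, hβ, exists_basis_deRhamH1 _ hβ⟩
  · have hβ : ∀ ij : ASIndex p h,
        betaTriple p h (ij.1.1 + 2) ij.1.1 ij.1.2 ∈ deRhamCocycles (asU₁ p h) (asU₂ p h) :=
      fun ij => betaTriple_mem _ ij (Nat.le_succ _) (by linear_combination hdp)
    exact ⟨alphaTriple_mem, hβ, exists_basis_deRhamH1 _ hβ⟩
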